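/- **Setting.** Let $(\bar M,\bar g)$ be a semi-Riemannian manifold of constant index with Levi-Civita connection $\bar\nabla$. Let $\bar J$ be a metallic structure on it: a smooth $(1,1)$-tensor field with $\bar J^2=p\bar J+qI$ for positive integers $p,q$ and $\bar g(U,\bar JV)=\bar g(\bar JU,V)$. Assume that $\bar J$ is parallel, $\bar\nabla\bar J=0$. Let $\eta$ be a smooth vector field on $\bar M$, let $\pi(U)=\bar g(U,\eta)$, and let $\bar D$ be the quarter symmetric connection $\bar D_UV=\bar\nabla_UV+\pi(V)\bar JU$. Let $M$ be an $r$-lightlike (immersed) submanifold of $\bar M$, $r>0$: $\mathrm{Rad}(TM)=TM\cap TM^\perp$ is a smooth distribution of rank $r$. Let $S(TM)$ and $S(TM^\perp)$ be smooth complements of $\mathrm{Rad}(TM)$ in $TM$ and in $TM^\perp$, and let $\mathrm{ltr}(TM)$ be a totally null smooth subbundle which is a complement of $\mathrm{Rad}(TM)$ in $(S(TM)\perp S(TM^\perp))^\perp$, so that $$T\bar M|_M=TM\oplus \mathrm{ltr}(TM)\oplus S(TM^\perp).$$ For $U,V\in\Gamma(TM)$ and $W\in\Gamma(S(TM^\perp))$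 let $D_UV$ be the $TM$-component of $\bar D_UV$, let $-\bar A_WU$ be the $TM$-component of $\bar D_UW$, and let $\bar D^l(U,W)$ be the $\mathrm{ltr}(TM)$-component of $\bar D_UW$. Suppose that $M$ is screen semi-invariant: there is a non-degenerate smooth distribution $B\subseteq S(TM)$, with orthogonal complement $B^\perp$ in $S(TM)$, such that $S(TM)=B\oplus B^\perp$, $\bar J(B)=B$, $\bar J(B^\perp)\subseteq S(TM^\perp)$ and $\bar J(\mathrm{Rad}(TM))=\mathrm{Rad}(TM)$. Put $B'=B\perp\mathrm{Rad}(TM)$. We say that $B'$ defines a totally geodesic foliation on $M$ if $D_UV\in\Gamma(B')$ for all $U,V\in\Gamma(B')$. **Theorem.** $B'$ defines a totally geodesic foliation on $M$ if and only if both of the following conditions hold: 1. $\bar g(\bar JE,\bar D^l(U,\bar JZ))=\bar g(\bar A_{\bar JZ}U,\bar JE)+\pi(\bar JZ)\,\bar g(\bar JU,\bar JE)$ for all $E\in\Gamma(\mathrm{Rad}(TM))$, $U\in\Gamma(B')$, $Z\in\Gamma(B^\perp)$; 2. $\bar g(\bar A_{\bar JZ}U,\bar JF)=-\pi(\bar JZ)\,\bar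 g(\bar JU,\bar JF)$ for all $F\in\Gamma(B)$, $U\in\Gamma(B')$, $Z\in\Gamma(B^\perp)$. -/

import Mathlib

open Bundle Manifold Set
open scoped Manifold ContDiff Topology

set_option linter.unusedSectionVars false

noncomputable section

namespace LightlikeGeometry

/-! ### Linear algebra of a nondegenerate symmetric form -/

section LinearAlgebra

variable {V : Type*} [AddCommGroup V] [Module ℝ V] [FiniteDimensional ℝ V]

/-- For a tangent space `T`, its radical `T ⊓ Tᗮ`, a screen `S`, a screen transversal space `W` and
a null complement `L` of the radical in `(S ⊔ W)ᗮ`, the whole space is the direct sum of `T`, `L`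
and `W`. -/
theorem decomposition (b : LinearMap.BilinForm ℝ V) (hs : b.IsSymm) (hn : b.Nondegenerate)
    (T S W L : Submodule ℝ V)
    (hS : (T ⊓ b.orthogonal T) ⊓ S = ⊥) (hS' : (T ⊓ b.orthogonal T) ⊔ S = T)
    (hW : (T ⊓ b.orthogonal T) ⊓ W = ⊥) (hW' : (T ⊓ b.orthogonal T) ⊔ W = b.orthogonal T)
    (hL' : (T ⊓ b.orthogonal T) ⊔ L = b.orthogonal (S ⊔ W))
    (hnull : ∀ v ∈ L, ∀ w ∈ L, b v w = 0) :
    IsCompl T (L ⊔ W) ∧ IsCompl L (T ⊔ W) := by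
  have hrefl : b.IsRefl := hs.isRefl
  have sy : ∀ x y, b x y = b y x := fun x y => hs.eq x y
  have hST : S ≤ T := hS' ▸ le_sup_right
  have hWN : W ≤ b.orthogonal T := hW' ▸ le_sup_right
  have hTT : b.orthogonal (b.orthogonal T) = T := b.orthogonal_orthogonal hn hrefl T
  have hLO : L ≤ b.orthogonal (S ⊔ W) := hL' ▸ le_sup_right
  -- the screen part of the space is nondegenerate
  have hdisj : Disjoint (S ⊔ W) (b.orthogonal (S ⊔ W)) := by
    rw [Submodule.disjoint_def]
    intro x hx hxo
    obtain ⟨s, hs1, w, hw1, rfl⟩ := Submodule.mem_sup.1 hx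
    have hTs : s ∈ b.orthogonal T := by
      intro t ht
      rw [← hS'] at ht
      obtain ⟨e, he, s', hs', rfl⟩ := Submodule.mem_sup.1 ht
      have h1 : b s' (s + w) = 0 := hxo s' (Submodule.mem_sup_left hs')
      have h2 : b s' w = 0 := hWN hw1 s' (hST hs')
      have h3 : b e s = 0 := by rw [sy]; exact he.2 s (hST hs1)
      have h4 : b s' s = 0 := by simpa [h2] using h1
      change b (e + s') s = 0
      simp [h3, h4]
    have hs0 : s = 0 := by
      have : s ∈ (T ⊓ b.orthogonal T) ⊓ S := ⟨⟨hST hs1, hTs⟩, hs1⟩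
      rw [hS] at this
      simpa using this
    have hTw : w ∈ b.orthogonal (b.orthogonal T) := by
      intro t ht
      rw [← hW'] at ht
      obtain ⟨e, he, w', hw', rfl⟩ := Submodule.mem_sup.1 ht
      have h1 : b w' (s + w) = 0 := hxo w' (Submodule.mem_sup_right hw')
      have h3 : b e w = 0 := hWN hw1 e he.1
      have h4 : b w' w = 0 := by simpa [hs0] using h1
      change b (e + w') w = 0
      simp [h3, h4]
    have hw0 : w = 0 := by
      rw [hTT] at hTw
      have : w ∈ (T ⊓ b.orthogonal T) ⊓ W := ⟨⟨hTw, hWN hw1⟩, hw1⟩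
      rw [hW] at this
      simpa using this
    simp [hs0, hw0]
  have htop : (S ⊔ W) ⊔ b.orthogonal (S ⊔ W) = ⊤ :=
    ((b.isCompl_orthogonal_iff_disjoint hrefl).2 hdisj).sup_eq_top
  have hcod : T ⊔ (L ⊔ W) = ⊤ := by
    rw [eq_top_iff, ← htop, ← hL']
    refine sup_le (sup_le (hST.trans le_sup_left) (le_sup_right.trans le_sup_right)) ?_
    exact sup_le (inf_le_left.trans le_sup_left) (le_sup_left.trans le_sup_right)
  -- an element of `L` orthogonal to the radical vanishes
  have hL0 : ∀ l ∈ L, (∀ e ∈ T ⊓ b.orthogonal T, b e l = 0) → l = 0 := by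
    intro l hl he
    have : l ∈ b.orthogonal ⊤ := by
      rw [← htop, ← hL']
      intro v hv
      obtain ⟨a, ha, c, hc, rfl⟩ := Submodule.mem_sup.1 hv
      obtain ⟨e, he', l', hl', rfl⟩ := Submodule.mem_sup.1 hc
      have h1 : b a l = 0 := hLO hl a ha
      change b (a + (e + l')) l = 0
      simp [h1, he e he', hnull l' hl' l hl]
    rw [b.orthogonal_top_eq_bot hn] at this
    simpa using this
  -- uniqueness of the decomposition
  have huniq : ∀ t ∈ T, ∀ l ∈ L, ∀ w ∈ W, t = l + w → l = 0 := by
    intro t ht l hl w hw h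
    refine hL0 l hl fun e he => ?_
    have h1 : b e t = 0 := by rw [sy]; exact he.2 t ht
    have h2 : b e w = 0 := hWN hw e he.1
    rw [h] at h1
    simpa [h2] using h1
  refine ⟨⟨?_, codisjoint_iff.2 hcod⟩, ⟨?_, codisjoint_iff.2 ?_⟩⟩
  · rw [Submodule.disjoint_def]
    intro x hx hx'
    obtain ⟨l, hl, w, hw, rfl⟩ := Submodule.mem_sup.1 hx'
    have hl0 := huniq _ hx l hl w hw rfl
    subst hl0
    have hx2 : w ∈ (T ⊓ b.orthogonal T) ⊓ W := ⟨⟨by simpa using hx, hWN hw⟩, hw⟩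
    rw [hW] at hx2
    simpa using hx2
  · rw [Submodule.disjoint_def]
    intro x hx hx'
    obtain ⟨t, ht, w, hw, rfl⟩ := Submodule.mem_sup.1 hx'
    exact huniq t ht _ hx (-w) (W.neg_mem hw) (by abel)
  · rw [← hcod]
    simp only [sup_comm, sup_left_comm]

end LinearAlgebra

/-! ### Tensor fields and connections on the ambient manifold -/

section Ambient

variable {E : Type*} [NormedAddCommGroup E] [NormedSpace ℝ E] [FiniteDimensional ℝ E]
  {N : Type*} [TopologicalSpace N] [ChartedSpace E N] [IsManifold 𝓘(ℝ, E) ∞ N]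

instance (x : N) : FiniteDimensional ℝ (TangentSpace 𝓘(ℝ, E) x) :=
  inferInstanceAs (FiniteDimensional ℝ E)

/-- A field of bilinear forms on the tangent spaces, seen pointwise as a bilinear form. -/
def formAt (g : Π x : N, TangentSpace 𝓘(ℝ, E) x →L[ℝ] TangentSpace 𝓘(ℝ, E) x →L[ℝ] ℝ) (x : N) :
    LinearMap.BilinForm ℝ (TangentSpace 𝓘(ℝ, E) x) :=
  (g x).toLinearMap₁₂

/-- A smooth semi-Riemannian metric on `N` of constant index `ν`. -/
structure IsSemiRiemannianMetric
    (g : Π x : N, TangentSpace 𝓘(ℝ, E) x →L[ℝ] TangentSpace 𝓘(ℝ, E) x →L[ℝ] ℝ) (ν : ℕ) : Prop where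
  smooth : ContMDiff 𝓘(ℝ, E) (𝓘(ℝ, E).prod 𝓘(ℝ, E →L[ℝ] E →L[ℝ] ℝ)) ∞
    (fun x ↦ TotalSpace.mk' (E →L[ℝ] E →L[ℝ] ℝ)
      (E := fun x : N ↦ TangentSpace 𝓘(ℝ, E) x →L[ℝ] TangentSpace 𝓘(ℝ, E) x →L[ℝ] ℝ) x (g x))
  symm : ∀ (x : N) (v w : TangentSpace 𝓘(ℝ, E) x), g x v w = g x w v
  nondegenerate : ∀ (x : N) (v : TangentSpace 𝓘(ℝ, E) x), (∀ w, g x v w = 0) → v = 0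
  index_eq : ∀ x : N, sigNeg (LinearMap.BilinMap.toQuadraticMap (formAt g x)) = ν

/-- A smooth vector field on `N`. -/
def IsSmoothVectorField (X : Π x : N, TangentSpace 𝓘(ℝ, E) x) : Prop :=
  ContMDiff 𝓘(ℝ, E) 𝓘(ℝ, E).tangent ∞ (fun x ↦ (⟨x, X x⟩ : TangentBundle 𝓘(ℝ, E) N))

/-- A metallic structure `J` on a semi-Riemannian manifold: a smooth `(1,1)`-tensor field with
`J² = p J + q I` for positive integers `p` and `q`, with which the metric is compatible. -/
structure IsMetallicStructure
    (g : Π x : N, TangentSpace 𝓘(ℝ, E) x →L[ℝ] TangentSpace 𝓘(ℝ, E) x →L[ℝ] ℝ)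
    (J : Π x : N, TangentSpace 𝓘(ℝ, E) x →L[ℝ] TangentSpace 𝓘(ℝ, E) x) (p q : ℕ) : Prop where
  p_pos : 0 < p
  q_pos : 0 < q
  smooth : ContMDiff 𝓘(ℝ, E) (𝓘(ℝ, E).prod 𝓘(ℝ, E →L[ℝ] E)) ∞
    (fun x ↦ TotalSpace.mk' (E →L[ℝ] E)
      (E := fun x : N ↦ TangentSpace 𝓘(ℝ, E) x →L[ℝ] TangentSpace 𝓘(ℝ, E) x) x (J x))
  sq_eq : ∀ (x : N) (v : TangentSpace 𝓘(ℝ, E) x),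
    J x (J x v) = (p : ℝ) • J x v + (q : ℝ) • v
  compatible : ∀ (x : N) (v w : TangentSpace 𝓘(ℝ, E) x), g x v (J x w) = g x (J x v) w

/-- `D` is the Levi-Civita connection of `g`: it is torsion free and `D g = 0`.
In Mathlib's notation, `D X x u` is the covariant derivative of `X` at `x` in direction `u`. -/
structure IsLeviCivita
    (g : Π x : N, TangentSpace 𝓘(ℝ, E) x →L[ℝ] TangentSpace 𝓘(ℝ, E) x →L[ℝ] ℝ)
    (D : CovariantDerivative 𝓘(ℝ, E) E (TangentSpace 𝓘(ℝ, E) : N → Type _)) : Prop where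
  torsion_eq_zero : ∀ (X Y : Π x : N, TangentSpace 𝓘(ℝ, E) x) (x : N),
    MDifferentiableAt 𝓘(ℝ, E) 𝓘(ℝ, E).tangent
      (fun y ↦ (⟨y, X y⟩ : TangentBundle 𝓘(ℝ, E) N)) x →
    MDifferentiableAt 𝓘(ℝ, E) 𝓘(ℝ, E).tangent
      (fun y ↦ (⟨y, Y y⟩ : TangentBundle 𝓘(ℝ, E) N)) x →
    D Y x (X x) - D X x (Y x) = VectorField.mlieBracket 𝓘(ℝ, E) X Y x
  metric : ∀ (X Y : Π x : N, TangentSpace 𝓘(ℝ, E) x) (x : N),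
    MDifferentiableAt 𝓘(ℝ, E) 𝓘(ℝ, E).tangent
      (fun y ↦ (⟨y, X y⟩ : TangentBundle 𝓘(ℝ, E) N)) x →
    MDifferentiableAt 𝓘(ℝ, E) 𝓘(ℝ, E).tangent
      (fun y ↦ (⟨y, Y y⟩ : TangentBundle 𝓘(ℝ, E) N)) x →
    ∀ u : TangentSpace 𝓘(ℝ, E) x,
      mvfderiv 𝓘(ℝ, E) (fun y ↦ g y (X y) (Y y)) x u = g x (D X x u) (Y x) + g x (X x) (D Y x u)

/-- The `(1,1)`-tensor field `J` is parallel for the connection `D`: `D_u (J X) = J (D_u X)`. -/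
def IsParallelTensor
    (D : CovariantDerivative 𝓘(ℝ, E) E (TangentSpace 𝓘(ℝ, E) : N → Type _))
    (J : Π x : N, TangentSpace 𝓘(ℝ, E) x →L[ℝ] TangentSpace 𝓘(ℝ, E) x) : Prop :=
  ∀ (X : Π x : N, TangentSpace 𝓘(ℝ, E) x) (x : N),
    MDifferentiableAt 𝓘(ℝ, E) 𝓘(ℝ, E).tangent
      (fun y ↦ (⟨y, X y⟩ : TangentBundle 𝓘(ℝ, E) N)) x →
    ∀ u : TangentSpace 𝓘(ℝ, E) x, D (fun y ↦ J y (X y)) x u = J x (D X x u)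

/-- The 1-form `v ↦ g(v, η) = g(η, v)` associated with the vector field `η`. -/
def associatedForm
    (g : Π x : N, TangentSpace 𝓘(ℝ, E) x →L[ℝ] TangentSpace 𝓘(ℝ, E) x →L[ℝ] ℝ)
    (η : Π x : N, TangentSpace 𝓘(ℝ, E) x) (x : N) : TangentSpace 𝓘(ℝ, E) x →L[ℝ] ℝ :=
  g x (η x)

/-- The quarter symmetric connection `X ↦ D_u X + pi(X) J u`. -/
def quarterSymmetric
    (D : CovariantDerivative 𝓘(ℝ, E) E (TangentSpace 𝓘(ℝ, E) : N → Type _))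
    (J : Π x : N, TangentSpace 𝓘(ℝ, E) x →L[ℝ] TangentSpace 𝓘(ℝ, E) x)
    (pi : Π x : N, TangentSpace 𝓘(ℝ, E) x →L[ℝ] ℝ) :
    CovariantDerivative 𝓘(ℝ, E) E (TangentSpace 𝓘(ℝ, E) : N → Type _) :=
  D.addOneForm (fun x ↦ (pi x).smulRight (J x))

end Ambient

/-! ### Fields along an immersion -/

section Along

variable {E : Type*} [NormedAddCommGroup E] [NormedSpace ℝ E] [FiniteDimensional ℝ E]
  {N : Type*} [TopologicalSpace N] [ChartedSpace E N] [IsManifold 𝓘(ℝ, E) ∞ N]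
  {F : Type*} [NormedAddCommGroup F] [NormedSpace ℝ F] [FiniteDimensional ℝ F]
  {M : Type*} [TopologicalSpace M] [ChartedSpace F M] [IsManifold 𝓘(ℝ, F) ∞ M]

/-- The derivative `D_u σ` at `x` of a section `σ` of `TN` along `ι : M → N`, in a direction `u`
tangent to `M` (the pull-back of the connection `D` by `ι`). With `e` the local trivialization of
`TN` around `ι x` and `σ = ∑ σⁱ eᵢ` in the frame `eᵢ` of `e`, it is
`∑ dσⁱ(u) eᵢ + ∑ σⁱ D_{dι u} eᵢ`; the second sum is the derivative of the vector field which has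
constant coordinates in `e` and the value `σ x` at `ι x`. -/
def along (D : CovariantDerivative 𝓘(ℝ, E) E (TangentSpace 𝓘(ℝ, E) : N → Type _)) (ι : M → N)
    (σ : Π x : M, TangentSpace 𝓘(ℝ, E) (ι x)) (x : M) (u : TangentSpace 𝓘(ℝ, F) x) :
    TangentSpace 𝓘(ℝ, E) (ι x) :=
  let e := trivializationAt E (TangentSpace 𝓘(ℝ, E) : N → Type _) (ι x)
  e.symm (ι x)
      (mvfderiv 𝓘(ℝ, F) (fun y ↦ (e (⟨ι y, σ y⟩ : TangentBundle 𝓘(ℝ, E) N)).2) x u)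
    + D (FiberBundle.extend E (σ x)) (ι x) (mfderiv 𝓘(ℝ, F) 𝓘(ℝ, E) ι x u)

/-- On the restriction to `M` of a vector field `X` of `N`, the derivative along `ι` is the ambient
one. -/
theorem along_comp (D : CovariantDerivative 𝓘(ℝ, E) E (TangentSpace 𝓘(ℝ, E) : N → Type _))
    (ι : M → N) (X : Π y : N, TangentSpace 𝓘(ℝ, E) y) (x : M)
    (hι : MDifferentiableAt 𝓘(ℝ, F) 𝓘(ℝ, E) ι x)
    (hX : MDifferentiableAt 𝓘(ℝ, E) 𝓘(ℝ, E).tangent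
      (fun y ↦ (⟨y, X y⟩ : TangentBundle 𝓘(ℝ, E) N)) (ι x)) (u : TangentSpace 𝓘(ℝ, F) x) :
    along D ι (fun y ↦ X (ι y)) x u = D X (ι x) (mfderiv 𝓘(ℝ, F) 𝓘(ℝ, E) ι x u) := by
  have : IsManifold 𝓘(ℝ, E) 1 N := IsManifold.of_le (n := ∞) (by simp)
  set p := ι x with hp
  set e := trivializationAt E (TangentSpace 𝓘(ℝ, E) : N → Type _) p with he
  have hpe : p ∈ e.baseSet := FiberBundle.mem_baseSet_trivializationAt' p
  let b := Module.finBasis ℝ E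
  let ex : Fin (Module.finrank ℝ E) → Π y : N, TangentSpace 𝓘(ℝ, E) y :=
    fun i ↦ FiberBundle.extend E (e.symm p (b i))
  let h : N → E := fun y ↦ (e (⟨y, X y⟩ : TangentBundle 𝓘(ℝ, E) N)).2
  let c : Fin (Module.finrank ℝ E) → N → ℝ := fun i y ↦ b.repr (h y) i
  have hexs : ∀ i y, ex i y = e.symm y (b i) := by
    intro i y
    change e.symm y (e ⟨p, e.symm p (b i)⟩).2 = _
    rw [e.apply_mk_symm hpe]
  have hsum : ∀ y ∈ e.baseSet, ∀ w : E, e.symm y w = ∑ i, b.repr w i • ex i y := by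
    intro y hy w
    have h1 := congrArg (e.symmₗ ℝ y) (b.sum_repr w)
    rw [map_sum] at h1
    simp only [map_smul] at h1
    simp only [e.symmₗ_apply (R := ℝ) hy] at h1
    simp only [hexs, h1]
  have hex : ∀ i, MDifferentiableAt 𝓘(ℝ, E) 𝓘(ℝ, E).tangent
      (fun y ↦ (⟨y, ex i y⟩ : TangentBundle 𝓘(ℝ, E) N)) p := fun i ↦
    FiberBundle.mdifferentiableAt_extend 𝓘(ℝ, E) E _
  have hh : MDifferentiableAt 𝓘(ℝ, E) 𝓘(ℝ, E) h p := (mdifferentiableAt_section _ X).1 hX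
  let L : Fin (Module.finrank ℝ E) → (E →L[ℝ] ℝ) := fun i ↦ LinearMap.toContinuousLinearMap (b.coord i)
  have hc : ∀ i, MDifferentiableAt 𝓘(ℝ, E) 𝓘(ℝ, ℝ) (c i) p := fun i ↦
    (L i).differentiableAt.mdifferentiableAt.comp p hh
  have hdc : ∀ i v, mvfderiv 𝓘(ℝ, E) (c i) p v = L i (mvfderiv 𝓘(ℝ, E) h p v) := by
    intro i v
    have := mfderiv_comp (I' := 𝓘(ℝ, E)) p (L i).differentiableAt.mdifferentiableAt hh
    simp only [mfderiv_eq_fderiv, ContinuousLinearMap.fderiv] at this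
    exact DFunLike.congr_fun this v
  have hDsum : ∀ (s : Finset (Fin (Module.finrank ℝ E)))
      (a : Fin (Module.finrank ℝ E) → N → ℝ), (∀ i, MDifferentiableAt 𝓘(ℝ, E) 𝓘(ℝ, ℝ) (a i) p) →
      MDifferentiableAt 𝓘(ℝ, E) 𝓘(ℝ, E).tangent
        (fun y ↦ (⟨y, (∑ i ∈ s, a i • ex i) y⟩ : TangentBundle 𝓘(ℝ, E) N)) p ∧
      D (∑ i ∈ s, a i • ex i) p =
        ∑ i ∈ s, (a i p • D (ex i) p + (mvfderiv 𝓘(ℝ, E) (a i) p).smulRight (ex i p)) := by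
    classical
    intro s a ha
    induction s using Finset.induction_on with
    | empty =>
      simp only [Finset.sum_empty]
      exact ⟨mdifferentiableAt_zeroSection .., D.isCovariantDerivativeOnUniv.zero⟩
    | insert i s hi ih =>
      have hi' : MDifferentiableAt 𝓘(ℝ, E) 𝓘(ℝ, E).tangent
        (fun y ↦ (⟨y, (a i • ex i) y⟩ : TangentBundle 𝓘(ℝ, E) N)) p := (ha i).smul_section (hex i)
      rw [Finset.sum_insert hi, Finset.sum_insert hi]
      refine ⟨mdifferentiableAt_add_section hi' ih.1, ?_⟩
      rw [D.isCovariantDerivativeOnUniv.add hi' ih.1, ih.2,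
        D.isCovariantDerivativeOnUniv.leibniz (hex i) (ha i)]
  have hXsum : ∀ᶠ y in 𝓝 p, X y = (∑ i, c i • ex i) y := by
    filter_upwards [e.open_baseSet.mem_nhds hpe] with y hy
    have := e.symm_proj_apply (⟨y, X y⟩ : TangentBundle 𝓘(ℝ, E) N) hy
    rw [Finset.sum_apply]
    exact this.symm.trans (hsum y hy (h y))
  have hDX := D.isCovariantDerivativeOnUniv.congr_of_eventuallyEq hX (hDsum Finset.univ c hc).1
    Filter.univ_mem hXsum
  rw [(hDsum _ c hc).2] at hDX
  let c' : Fin (Module.finrank ℝ E) → N → ℝ := fun i _ ↦ c i p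
  have hc' : ∀ i, MDifferentiableAt 𝓘(ℝ, E) 𝓘(ℝ, ℝ) (c' i) p := fun i ↦ mdifferentiableAt_const
  have hext : ∀ᶠ y in 𝓝 p, FiberBundle.extend E (X p) y = (∑ i, c' i • ex i) y := by
    filter_upwards [e.open_baseSet.mem_nhds hpe] with y hy
    rw [Finset.sum_apply]
    exact hsum y hy (h p)
  have hDe := D.isCovariantDerivativeOnUniv.congr_of_eventuallyEq
    (FiberBundle.mdifferentiableAt_extend 𝓘(ℝ, E) E (X p)) (hDsum Finset.univ c' hc').1
    Filter.univ_mem hext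
  rw [(hDsum _ c' hc').2] at hDe
  have hcomp : mvfderiv 𝓘(ℝ, F) (fun y ↦ h (ι y)) x u
      = mvfderiv 𝓘(ℝ, E) h p (mfderiv 𝓘(ℝ, F) 𝓘(ℝ, E) ι x u) :=
    DFunLike.congr_fun (mfderiv_comp (I' := 𝓘(ℝ, E)) x hh hι) u
  change e.symm p (mvfderiv 𝓘(ℝ, F) (fun y ↦ h (ι y)) x u) +
    D (FiberBundle.extend E (X p)) p (mfderiv 𝓘(ℝ, F) 𝓘(ℝ, E) ι x u) = _
  have hd0 : ∀ i v, mvfderiv 𝓘(ℝ, E) (c' i) p v = 0 := fun i v ↦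
    DFunLike.congr_fun (mvfderiv_const (c i p)) v
  rw [hcomp, hDe, hDX, hsum p hpe]
  simp only [sum_apply, add_apply,
    ContinuousLinearMap.smulRight_apply, FunLike.coe_smul, hd0, Pi.smul_apply, hdc,
    Finset.sum_add_distrib]
  simp [L, c', add_comm]

/-- The section `σ` of `TN` along `ι` is smooth. -/
def IsSmoothAlong (ι : M → N) (σ : Π x : M, TangentSpace 𝓘(ℝ, E) (ι x)) : Prop :=
  ContMDiff 𝓘(ℝ, F) 𝓘(ℝ, E).tangent ∞ (fun x ↦ (⟨ι x, σ x⟩ : TangentBundle 𝓘(ℝ, E) N))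

/-- The spaces `P x` form a smooth vector subbundle of rank `k` of `TN` restricted to `M`. -/
def IsSubbundle (ι : M → N) (P : Π x : M, Submodule ℝ (TangentSpace 𝓘(ℝ, E) (ι x))) (k : ℕ) :
    Prop :=
  ∀ x₀ : M, ∃ O : Set M, IsOpen O ∧ x₀ ∈ O ∧
    ∃ s : Fin k → Π x : M, TangentSpace 𝓘(ℝ, E) (ι x),
      (∀ i, ContMDiffOn 𝓘(ℝ, F) 𝓘(ℝ, E).tangent ∞
        (fun x ↦ (⟨ι x, s i x⟩ : TangentBundle 𝓘(ℝ, E) N)) O) ∧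
      ∀ x ∈ O, LinearIndependent ℝ (fun i ↦ s i x) ∧
        Submodule.span ℝ (Set.range fun i ↦ s i x) = P x

/-- `σ ∈ Γ(P)`: `σ` is a smooth section of `TN` along `ι` with values in `P`. -/
def IsSection (ι : M → N) (P : Π x : M, Submodule ℝ (TangentSpace 𝓘(ℝ, E) (ι x)))
    (σ : Π x : M, TangentSpace 𝓘(ℝ, E) (ι x)) : Prop :=
  IsSmoothAlong (F := F) ι σ ∧ ∀ x, σ x ∈ P x

/-- The tangent space of the immersed manifold, as a subspace of the tangent space of `N`. -/
def tangentSpaceOf (ι : M → N) (x : M) : Submodule ℝ (TangentSpace 𝓘(ℝ, E) (ι x)) :=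
  LinearMap.range (mfderiv 𝓘(ℝ, F) 𝓘(ℝ, E) ι x).toLinearMap

/-- The push-forward of the vector field `U` of `M`, a section of `TN` along `ι`. -/
def push (ι : M → N) (U : Π x : M, TangentSpace 𝓘(ℝ, F) x) (x : M) :
    TangentSpace 𝓘(ℝ, E) (ι x) :=
  mfderiv 𝓘(ℝ, F) 𝓘(ℝ, E) ι x (U x)

variable (F) in
/-- The radical `Rad(TM) = TM ∩ TM^⊥`. -/
def radical (g : Π x : N, TangentSpace 𝓘(ℝ, E) x →L[ℝ] TangentSpace 𝓘(ℝ, E) x →L[ℝ] ℝ)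
    (ι : M → N) (x : M) : Submodule ℝ (TangentSpace 𝓘(ℝ, E) (ι x)) :=
  tangentSpaceOf (F := F) ι x ⊓ (formAt g (ι x)).orthogonal (tangentSpaceOf (F := F) ι x)

variable (F) in
/-- An `r`-lightlike immersed submanifold `ι : M → N` of `(N, g)`, with a screen distribution
`S(TM)`, a screen transversal bundle `S(TM^⊥)` and a lightlike transversal bundle `ltr(TM)`. -/
structure LightlikeSubmanifold
    (g : Π x : N, TangentSpace 𝓘(ℝ, E) x →L[ℝ] TangentSpace 𝓘(ℝ, E) x →L[ℝ] ℝ)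
    (ι : M → N) (r : ℕ) where
  /-- `S(TM)` -/
  screen : Π x : M, Submodule ℝ (TangentSpace 𝓘(ℝ, E) (ι x))
  /-- `S(TM^⊥)` -/
  screenTr : Π x : M, Submodule ℝ (TangentSpace 𝓘(ℝ, E) (ι x))
  /-- `ltr(TM)` -/
  ltr : Π x : M, Submodule ℝ (TangentSpace 𝓘(ℝ, E) (ι x))
  immersion : Manifold.IsImmersion 𝓘(ℝ, F) 𝓘(ℝ, E) ∞ ι
  r_pos : 0 < r
  radical_subbundle : IsSubbundle (F := F) ι (radical F g ι) r
  screen_subbundle : ∃ k, IsSubbundle (F := F) ι screen k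
  screen_inf : ∀ x, radical F g ι x ⊓ screen x = ⊥
  screen_sup : ∀ x, radical F g ι x ⊔ screen x = tangentSpaceOf (F := F) ι x
  screenTr_subbundle : ∃ k, IsSubbundle (F := F) ι screenTr k
  screenTr_inf : ∀ x, radical F g ι x ⊓ screenTr x = ⊥
  screenTr_sup : ∀ x, radical F g ι x ⊔ screenTr x =
    (formAt g (ι x)).orthogonal (tangentSpaceOf (F := F) ι x)
  ltr_subbundle : IsSubbundle (F := F) ι ltr r
  ltr_null : ∀ x, ∀ v ∈ ltr x, ∀ w ∈ ltr x, g (ι x) v w = 0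
  ltr_inf : ∀ x, radical F g ι x ⊓ ltr x = ⊥
  ltr_sup : ∀ x, radical F g ι x ⊔ ltr x =
    (formAt g (ι x)).orthogonal (screen x ⊔ screenTr x)

namespace LightlikeSubmanifold

variable {g : Π x : N, TangentSpace 𝓘(ℝ, E) x →L[ℝ] TangentSpace 𝓘(ℝ, E) x →L[ℝ] ℝ}
  {ι : M → N} {r ν : ℕ} (H : LightlikeSubmanifold F g ι r) (hg : IsSemiRiemannianMetric g ν)
  (D : CovariantDerivative 𝓘(ℝ, E) E (TangentSpace 𝓘(ℝ, E) : N → Type _))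

/-- `TN` restricted to `M` is the direct sum of `TM`, `ltr(TM)` and `S(TM^⊥)`. -/
theorem isCompl (H : LightlikeSubmanifold F g ι r) (hg : IsSemiRiemannianMetric g ν) (x : M) :
    IsCompl (tangentSpaceOf (F := F) ι x) (H.ltr x ⊔ H.screenTr x) ∧
      IsCompl (H.ltr x) (tangentSpaceOf (F := F) ι x ⊔ H.screenTr x) := by
  have hs : (formAt g (ι x)).IsSymm := ⟨fun v w ↦ hg.symm (ι x) v w⟩
  have hn : (formAt g (ι x)).Nondegenerate :=
    hs.isRefl.nondegenerate_iff_separatingLeft.2 fun v hv ↦ hg.nondegenerate (ι x) v hv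
  exact decomposition (formAt g (ι x)) hs hn _ _ _ _ (H.screen_inf x) (H.screen_sup x)
    (H.screenTr_inf x) (H.screenTr_sup x) (H.ltr_sup x) (H.ltr_null x)

/-- The `TM`-component along `TM ⊕ ltr(TM) ⊕ S(TM^⊥)`. -/
def tangentPart (x : M) :
    TangentSpace 𝓘(ℝ, E) (ι x) →ₗ[ℝ] TangentSpace 𝓘(ℝ, E) (ι x) :=
  Submodule.projection _ _ (H.isCompl hg x).1

/-- The `ltr(TM)`-component along `TM ⊕ ltr(TM) ⊕ S(TM^⊥)`. -/
def ltrPart (x : M) :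
    TangentSpace 𝓘(ℝ, E) (ι x) →ₗ[ℝ] TangentSpace 𝓘(ℝ, E) (ι x) :=
  Submodule.projection _ _ (H.isCompl hg x).2

/-- The connection induced on `M` by `D`: the tangential part of `D_U V`. -/
def inducedConnection (U : Π x : M, TangentSpace 𝓘(ℝ, F) x)
    (V : Π x : M, TangentSpace 𝓘(ℝ, E) (ι x)) (x : M) : TangentSpace 𝓘(ℝ, E) (ι x) :=
  H.tangentPart hg x (along D ι V x (U x))

/-- The shape operator `A_W U`: minus the tangential part of `D_U W`. -/
def shape (W : Π x : M, TangentSpace 𝓘(ℝ, E) (ι x))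
    (U : Π x : M, TangentSpace 𝓘(ℝ, F) x) (x : M) : TangentSpace 𝓘(ℝ, E) (ι x) :=
  -H.tangentPart hg x (along D ι W x (U x))

/-- `D^l(U, W)`: the `ltr(TM)`-part of `D_U W`. -/
def ltrDeriv (U : Π x : M, TangentSpace 𝓘(ℝ, F) x)
    (W : Π x : M, TangentSpace 𝓘(ℝ, E) (ι x)) (x : M) : TangentSpace 𝓘(ℝ, E) (ι x) :=
  H.ltrPart hg x (along D ι W x (U x))

/-- The distribution `P ⊆ TM` defines a totally geodesic foliation on `M` with respect to the
connection induced by `D`: the induced derivative of sections of `P` stays in `P`. -/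
def DefinesTotallyGeodesicFoliation
    (P : Π x : M, Submodule ℝ (TangentSpace 𝓘(ℝ, E) (ι x))) : Prop :=
  ∀ (U : Π x : M, TangentSpace 𝓘(ℝ, F) x) (V : Π x : M, TangentSpace 𝓘(ℝ, E) (ι x)),
    IsSmoothVectorField U → IsSection (F := F) ι P (push ι U) → IsSection (F := F) ι P V →
    ∀ x, H.inducedConnection hg D U V x ∈ P x

/-- The orthogonal complement `B^⊥` of `B` in `S(TM)`. -/
def perpInScreen (B : Π x : M, Submodule ℝ (TangentSpace 𝓘(ℝ, E) (ι x))) (x : M) :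
    Submodule ℝ (TangentSpace 𝓘(ℝ, E) (ι x)) :=
  H.screen x ⊓ (formAt g (ι x)).orthogonal (B x)

/-- `M` is screen semi-invariant, through the distribution `B ⊆ S(TM)`. -/
structure IsScreenSemiInvariant
    (J : Π x : N, TangentSpace 𝓘(ℝ, E) x →L[ℝ] TangentSpace 𝓘(ℝ, E) x)
    (B : Π x : M, Submodule ℝ (TangentSpace 𝓘(ℝ, E) (ι x))) : Prop where
  subbundle : ∃ k, IsSubbundle (F := F) ι B k
  le_screen : ∀ x, B x ≤ H.screen x
  non_null : ∀ x, ∀ v ∈ B x, (∀ w ∈ B x, g (ι x) v w = 0) → v = 0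
  inf_perp : ∀ x, B x ⊓ H.perpInScreen B x = ⊥
  sup_perp : ∀ x, B x ⊔ H.perpInScreen B x = H.screen x
  map_eq : ∀ x, (B x).map (J (ι x)).toLinearMap = B x
  map_perp_le : ∀ x, (H.perpInScreen B x).map (J (ι x)).toLinearMap ≤ H.screenTr x
  map_radical : ∀ x, (radical F g ι x).map (J (ι x)).toLinearMap = radical F g ι x

end LightlikeSubmanifold

end Along

end LightlikeGeometry

end

open LightlikeGeometry

/-!
Write `∇` for the Levi-Civita connection and `D` for the quarter symmetric one, both pulled back to
sections of `TN` along the immersion, and `B' = B ⊕ Rad(TM)`. Everything reduces to the products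
`g(∇_U V, Z)` with `U, V` in `B'` and `Z` in `B^⊥`.

* `B'` is the orthogonal complement of `B^⊥` in `TM` (`mem_of_inner_perp`). A section `Z` of `B^⊥` is
  orthogonal to `ltr(TM)`, to `S(TM^⊥)` and to the term `π(V) J U`, which lies in `B'`. Hence the
  induced derivative of `V` lies in `B'` exactly when `g(∇_U V, Z) = 0` for all `Z` in `B^⊥`
  (`inducedConnection_mem_iff`).
* Removing from the two conditions the terms with `π` and the components that are orthogonal for
  algebraic reasons, they say `g(J E, ∇_U (J Z)) = 0` for `E` in `Rad(TM)` and
  `g(J F, ∇_U (J Z)) = 0` for `F` in `B` (`radical_condition_iff`, `screen_condition_iff`).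
* As `J` is parallel and self-adjoint, `g(J V, ∇_U (J Z)) = g(J² V, ∇_U Z)`, and as `V` and `Z` are
  orthogonal and `∇` is metric, `g(V, ∇_U Z) = - g(∇_U V, Z)` (`inner_map_along_map`,
  `inner_along_eq_neg`). Since `J²` maps `Rad(TM)` and `B` onto themselves, the two conditions
  together are the one of the first item.

The last step compares values at a point, so vectors of `Rad(TM)`, `B` and `B^⊥` must extend to
smooth global sections. For the first two this is `IsSubbundle.exists_isSection`; for `B^⊥`, which is
only given as an orthogonal complement, it is `exists_isSection_perp`. That `∇` is metric and `J`
parallel along the immersion follows from the ambient facts by `DiffAlongAt.induction`: near a point,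
a section along the immersion is a combination of restrictions of ambient vector fields.
-/

namespace LightlikeGeometry

/-! ### Differentiable and smooth sections along a map -/

section SectionsAlong

variable {E : Type*} [NormedAddCommGroup E] [NormedSpace ℝ E] [FiniteDimensional ℝ E]
  {N : Type*} [TopologicalSpace N] [ChartedSpace E N] [IsManifold 𝓘(ℝ, E) ∞ N]
  {F : Type*} [NormedAddCommGroup F] [NormedSpace ℝ F] [FiniteDimensional ℝ F]
  {M : Type*} [TopologicalSpace M] [ChartedSpace F M] [IsManifold 𝓘(ℝ, F) ∞ M]

variable (F) in
/-- The section `σ` of `TN` along `ι` is differentiable at `x`. -/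
abbrev DiffAlongAt (ι : M → N) (σ : Π x : M, TangentSpace 𝓘(ℝ, E) (ι x)) (x : M) : Prop :=
  MDifferentiableAt 𝓘(ℝ, F) 𝓘(ℝ, E).tangent
    (fun y ↦ (⟨ι y, σ y⟩ : TangentBundle 𝓘(ℝ, E) N)) x

variable (F) in
/-- The section `σ` of `TN` along `ι` is smooth at `x`. -/
abbrev SmoothAlongAt (ι : M → N) (σ : Π x : M, TangentSpace 𝓘(ℝ, E) (ι x)) (x : M) : Prop :=
  ContMDiffAt 𝓘(ℝ, F) 𝓘(ℝ, E).tangent ∞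
    (fun y ↦ (⟨ι y, σ y⟩ : TangentBundle 𝓘(ℝ, E) N)) x

/-- The coordinates of a section along `ι`, in the trivialization of `TN` around `ι x`. -/
noncomputable def coordsAlong (ι : M → N) (x : M) (σ : Π x : M, TangentSpace 𝓘(ℝ, E) (ι x))
    (y : M) : E :=
  (trivializationAt E (TangentSpace 𝓘(ℝ, E) : N → Type _) (ι x)
    (⟨ι y, σ y⟩ : TangentBundle 𝓘(ℝ, E) N)).2

variable {ι : M → N} {σ τ : Π x : M, TangentSpace 𝓘(ℝ, E) (ι x)} {c : M → ℝ} {x : M}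

theorem diffAlongAt_iff : DiffAlongAt F ι σ x ↔
    MDifferentiableAt 𝓘(ℝ, F) 𝓘(ℝ, E) ι x ∧
      MDifferentiableAt 𝓘(ℝ, F) 𝓘(ℝ, E) (coordsAlong ι x σ) x := by
  have : IsManifold 𝓘(ℝ, E) 1 N := IsManifold.of_le (n := ∞) (by simp)
  exact mdifferentiableAt_totalSpace 𝓘(ℝ, E)
    (fun y ↦ (⟨ι y, σ y⟩ : TangentBundle 𝓘(ℝ, E) N))

theorem smoothAlongAt_iff : SmoothAlongAt F ι σ x ↔
    ContMDiffAt 𝓘(ℝ, F) 𝓘(ℝ, E) ∞ ι x ∧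
      ContMDiffAt 𝓘(ℝ, F) 𝓘(ℝ, E) ∞ (coordsAlong ι x σ) x := by
  exact contMDiffAt_totalSpace (IB := 𝓘(ℝ, E)) (IM := 𝓘(ℝ, F))
    (f := fun y ↦ (⟨ι y, σ y⟩ : TangentBundle 𝓘(ℝ, E) N))

theorem eventually_mem_baseSet (hι : ContinuousAt ι x) : ∀ᶠ y in 𝓝 x,
    ι y ∈ (trivializationAt E (TangentSpace 𝓘(ℝ, E) : N → Type _) (ι x)).baseSet :=
  hι ((trivializationAt E (TangentSpace 𝓘(ℝ, E) : N → Type _) (ι x)).open_baseSet.mem_nhds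
    (FiberBundle.mem_baseSet_trivializationAt' (ι x)))

theorem coordsAlong_add (hι : ContinuousAt ι x) :
    coordsAlong ι x (σ + τ) =ᶠ[𝓝 x] coordsAlong ι x σ + coordsAlong ι x τ := by
  filter_upwards [eventually_mem_baseSet (E := E) hι] with y hy
  exact (Trivialization.linear (R := ℝ)
    (trivializationAt E (TangentSpace 𝓘(ℝ, E) : N → Type _) (ι x)) hy).map_add _ _

theorem coordsAlong_smul (hι : ContinuousAt ι x) :
    coordsAlong ι x (fun y ↦ c y • σ y) =ᶠ[𝓝 x] c • coordsAlong ι x σ := by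
  filter_upwards [eventually_mem_baseSet (E := E) hι] with y hy
  exact (Trivialization.linear (R := ℝ)
    (trivializationAt E (TangentSpace 𝓘(ℝ, E) : N → Type _) (ι x)) hy).map_smul _ _

theorem DiffAlongAt.add (hσ : DiffAlongAt F ι σ x) (hτ : DiffAlongAt F ι τ x) :
    DiffAlongAt F ι (σ + τ) x := by
  rw [diffAlongAt_iff] at *
  exact ⟨hσ.1, (hσ.2.add hτ.2).congr_of_eventuallyEq (coordsAlong_add hσ.1.continuousAt)⟩

theorem DiffAlongAt.smul (hc : MDifferentiableAt 𝓘(ℝ, F) 𝓘(ℝ, ℝ) c x)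
    (hσ : DiffAlongAt F ι σ x) : DiffAlongAt F ι (fun y ↦ c y • σ y) x := by
  rw [diffAlongAt_iff] at *
  exact ⟨hσ.1, (hc.smul hσ.2).congr_of_eventuallyEq (coordsAlong_smul hσ.1.continuousAt)⟩

theorem SmoothAlongAt.add (hσ : SmoothAlongAt F ι σ x) (hτ : SmoothAlongAt F ι τ x) :
    SmoothAlongAt F ι (σ + τ) x := by
  rw [smoothAlongAt_iff] at *
  exact ⟨hσ.1, (hσ.2.add hτ.2).congr_of_eventuallyEq (coordsAlong_add hσ.1.continuousAt)⟩

theorem SmoothAlongAt.smul (hc : ContMDiffAt 𝓘(ℝ, F) 𝓘(ℝ, ℝ) ∞ c x)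
    (hσ : SmoothAlongAt F ι σ x) : SmoothAlongAt F ι (fun y ↦ c y • σ y) x := by
  rw [smoothAlongAt_iff] at *
  exact ⟨hσ.1, (hc.smul hσ.2).congr_of_eventuallyEq (coordsAlong_smul hσ.1.continuousAt)⟩

theorem smoothAlongAt_zero (hι : ContMDiffAt 𝓘(ℝ, F) 𝓘(ℝ, E) ∞ ι x) :
    SmoothAlongAt F ι (0 : Π x : M, TangentSpace 𝓘(ℝ, E) (ι x)) x :=
  (contMDiff_zeroSection ℝ (TangentSpace 𝓘(ℝ, E) : N → Type _)).contMDiffAt.comp x hι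

theorem SmoothAlongAt.sum {κ : Type*} (s : Finset κ) (hι : ContMDiffAt 𝓘(ℝ, F) 𝓘(ℝ, E) ∞ ι x)
    {ρ : κ → Π x : M, TangentSpace 𝓘(ℝ, E) (ι x)} (hρ : ∀ i ∈ s, SmoothAlongAt F ι (ρ i) x) :
    SmoothAlongAt F ι (∑ i ∈ s, ρ i) x := by
  classical
  induction s using Finset.induction_on with
  | empty => exact smoothAlongAt_zero hι
  | insert i s hi ih =>
    rw [Finset.sum_insert hi]
    exact (hρ i (by simp)).add (ih fun j hj ↦ hρ j (by simp [hj]))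

theorem SmoothAlongAt.diffAlongAt (hσ : SmoothAlongAt F ι σ x) : DiffAlongAt F ι σ x :=
  ContMDiffAt.mdifferentiableAt hσ (by simp)

/-- Every differentiable section along `ι` is near `x` a combination, with differentiable
coefficients, of restrictions of ambient vector fields; hence a local property which is stable
under such combinations need only be checked on restrictions. -/
theorem DiffAlongAt.induction {P : (Π x : M, TangentSpace 𝓘(ℝ, E) (ι x)) → Prop}
    (restrict : ∀ X : Π y : N, TangentSpace 𝓘(ℝ, E) y, MDifferentiableAt 𝓘(ℝ, E) 𝓘(ℝ, E).tangent
      (fun y ↦ (⟨y, X y⟩ : TangentBundle 𝓘(ℝ, E) N)) (ι x) → P (fun y ↦ X (ι y)))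
    (add : ∀ ρ₁ ρ₂, DiffAlongAt F ι ρ₁ x → DiffAlongAt F ι ρ₂ x → P ρ₁ → P ρ₂ → P (ρ₁ + ρ₂))
    (smul : ∀ (a : M → ℝ) ρ, MDifferentiableAt 𝓘(ℝ, F) 𝓘(ℝ, ℝ) a x → DiffAlongAt F ι ρ x →
      P ρ → P (fun y ↦ a y • ρ y))
    (congr : ∀ ρ₁ ρ₂, (∀ᶠ y in 𝓝 x, ρ₁ y = ρ₂ y) → P ρ₁ → P ρ₂)
    (hσ : DiffAlongAt F ι σ x) : P σ := by
  have : IsManifold 𝓘(ℝ, E) 1 N := IsManifold.of_le (n := ∞) (by simp)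
  obtain ⟨hι, hcoord⟩ := diffAlongAt_iff.1 hσ
  set e := trivializationAt E (TangentSpace 𝓘(ℝ, E) : N → Type _) (ι x) with he
  have hxe : ι x ∈ e.baseSet := FiberBundle.mem_baseSet_trivializationAt' (ι x)
  let b := Module.finBasis ℝ E
  let X : Fin (Module.finrank ℝ E) → Π y : N, TangentSpace 𝓘(ℝ, E) y :=
    fun i ↦ FiberBundle.extend E (e.symm (ι x) (b i))
  have hX : ∀ i, MDifferentiableAt 𝓘(ℝ, E) 𝓘(ℝ, E).tangent
      (fun y ↦ (⟨y, X i y⟩ : TangentBundle 𝓘(ℝ, E) N)) (ι x) := fun i ↦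
    FiberBundle.mdifferentiableAt_extend 𝓘(ℝ, E) E _
  have hXs : ∀ i y, X i y = e.symm y (b i) := by
    intro i y
    change e.symm y (e ⟨ι x, e.symm (ι x) (b i)⟩).2 = _
    rw [e.apply_mk_symm hxe]
  have hsum : ∀ y ∈ e.baseSet, ∀ w : E, e.symm y w = ∑ i, b.repr w i • X i y := by
    intro y hy w
    have h1 := congrArg (e.symmₗ ℝ y) (b.sum_repr w)
    rw [map_sum] at h1
    simp only [map_smul] at h1
    simp only [e.symmₗ_apply (R := ℝ) hy] at h1
    simp only [hXs, h1]
  let a : Fin (Module.finrank ℝ E) → M → ℝ := fun i y ↦ b.repr (coordsAlong ι x σ y) i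
  have ha : ∀ i, MDifferentiableAt 𝓘(ℝ, F) 𝓘(ℝ, ℝ) (a i) x := fun i ↦
    (LinearMap.toContinuousLinearMap (b.coord i)).differentiableAt.mdifferentiableAt.comp x hcoord
  have hXι : ∀ i, DiffAlongAt F ι (fun y ↦ X i (ι y)) x := fun i ↦ (hX i).comp x hι
  have hzero : DiffAlongAt F ι (0 : Π x : M, TangentSpace 𝓘(ℝ, E) (ι x)) x :=
    (mdifferentiableAt_zeroSection (F := E) (E := (TangentSpace 𝓘(ℝ, E) : N → Type _)) ..).comp x hι
  have hs : ∀ s : Finset (Fin (Module.finrank ℝ E)),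
      DiffAlongAt F ι (∑ i ∈ s, fun y ↦ a i y • X i (ι y)) x ∧
        P (∑ i ∈ s, fun y ↦ a i y • X i (ι y)) := by
    classical
    intro s
    induction s using Finset.induction_on with
    | empty => exact ⟨hzero, restrict 0 (mdifferentiableAt_zeroSection ..)⟩
    | insert i s hi ih =>
      rw [Finset.sum_insert hi]
      exact ⟨((hXι i).smul (ha i)).add ih.1, add _ _ ((hXι i).smul (ha i)) ih.1
        (smul _ _ (ha i) (hXι i) (restrict _ (hX i))) ih.2⟩
  refine congr _ σ ?_ (hs Finset.univ).2
  filter_upwards [eventually_mem_baseSet (E := E) hι.continuousAt] with y hy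
  rw [Finset.sum_apply]
  exact (hsum _ hy _).symm.trans (e.symm_proj_apply (⟨ι y, σ y⟩ : TangentBundle 𝓘(ℝ, E) N) hy)

/-! ### The rules of the pulled-back derivative -/

section Along

variable (D : CovariantDerivative 𝓘(ℝ, E) E (TangentSpace 𝓘(ℝ, E) : N → Type _))

/-- The definition of `along` with the linear inverse of the trivialization. -/
theorem along_eq (σ : Π x : M, TangentSpace 𝓘(ℝ, E) (ι x)) (u : TangentSpace 𝓘(ℝ, F) x) :
    along D ι σ x u =
      (trivializationAt E (TangentSpace 𝓘(ℝ, E) : N → Type _) (ι x)).symmₗ ℝ (ι x)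
          (mvfderiv 𝓘(ℝ, F) (coordsAlong ι x σ) x u)
        + D (FiberBundle.extend E (σ x)) (ι x) (mfderiv 𝓘(ℝ, F) 𝓘(ℝ, E) ι x u) := by
  rw [Trivialization.symmₗ_apply (R := ℝ) _ (FiberBundle.mem_baseSet_trivializationAt' (ι x))]
  rfl

theorem mvfderiv_congr {G : Type*} [NormedAddCommGroup G] [NormedSpace ℝ G] {f₁ f₂ : M → G}
    (h : f₁ =ᶠ[𝓝 x] f₂) : mvfderiv 𝓘(ℝ, F) f₁ x = mvfderiv 𝓘(ℝ, F) f₂ x := by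
  ext u
  exact DFunLike.congr_fun (h.mfderiv_eq (I := 𝓘(ℝ, F)) (I' := 𝓘(ℝ, G))) u

theorem along_congr (h : ∀ᶠ y in 𝓝 x, σ y = τ y) (u : TangentSpace 𝓘(ℝ, F) x) :
    along D ι σ x u = along D ι τ x u := by
  have h1 : coordsAlong ι x σ =ᶠ[𝓝 x] coordsAlong ι x τ := by
    filter_upwards [h] with y hy
    simp only [coordsAlong, hy]
  rw [along_eq, along_eq, mvfderiv_congr h1, h.self_of_nhds]

theorem mdifferentiableAt_extend (v : TangentSpace 𝓘(ℝ, E) (ι x)) :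
    MDifferentiableAt 𝓘(ℝ, E) 𝓘(ℝ, E).tangent
      (fun y ↦ (⟨y, FiberBundle.extend E v y⟩ : TangentBundle 𝓘(ℝ, E) N)) (ι x) := by
  have : IsManifold 𝓘(ℝ, E) 1 N := IsManifold.of_le (n := ∞) (by simp)
  exact FiberBundle.mdifferentiableAt_extend 𝓘(ℝ, E) E v

theorem covariantDerivative_extend_add (v w : TangentSpace 𝓘(ℝ, E) (ι x)) :
    D (FiberBundle.extend E (v + w)) (ι x) =
      D (FiberBundle.extend E v) (ι x) + D (FiberBundle.extend E w) (ι x) := by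
  set e := trivializationAt E (TangentSpace 𝓘(ℝ, E) : N → Type _) (ι x) with he
  have hxe : ι x ∈ e.baseSet := FiberBundle.mem_baseSet_trivializationAt' (ι x)
  have h1 : (e ⟨ι x, v + w⟩).2 = (e ⟨ι x, v⟩).2 + (e ⟨ι x, w⟩).2 :=
    (Trivialization.linear (R := ℝ) e hxe).map_add v w
  have h2 : ∀ᶠ y in 𝓝 (ι x), FiberBundle.extend E (v + w) y =
      (FiberBundle.extend E v + FiberBundle.extend E w : Π y : N, TangentSpace 𝓘(ℝ, E) y) y := by
    filter_upwards [e.open_baseSet.mem_nhds hxe] with y hy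
    change e.symm y (e ⟨ι x, v + w⟩).2 = e.symm y (e ⟨ι x, v⟩).2 + e.symm y (e ⟨ι x, w⟩).2
    rw [h1, ← e.symmₗ_apply (R := ℝ) hy, ← e.symmₗ_apply (R := ℝ) hy, ← e.symmₗ_apply (R := ℝ) hy,
      map_add]
  have : IsManifold 𝓘(ℝ, E) 1 N := IsManifold.of_le (n := ∞) (by simp)
  have hv := mdifferentiableAt_extend v
  have hw := mdifferentiableAt_extend w
  rw [D.isCovariantDerivativeOnUniv.congr_of_eventuallyEq (mdifferentiableAt_extend (v + w))
    (mdifferentiableAt_add_section hv hw) Filter.univ_mem h2,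
    D.isCovariantDerivativeOnUniv.add hv hw]

theorem covariantDerivative_extend_smul (a : ℝ) (v : TangentSpace 𝓘(ℝ, E) (ι x)) :
    D (FiberBundle.extend E (a • v)) (ι x) = a • D (FiberBundle.extend E v) (ι x) := by
  set e := trivializationAt E (TangentSpace 𝓘(ℝ, E) : N → Type _) (ι x) with he
  have hxe : ι x ∈ e.baseSet := FiberBundle.mem_baseSet_trivializationAt' (ι x)
  have h1 : (e ⟨ι x, a • v⟩).2 = a • (e ⟨ι x, v⟩).2 :=
    (Trivialization.linear (R := ℝ) e hxe).map_smul a v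
  have h2 : ∀ᶠ y in 𝓝 (ι x), FiberBundle.extend E (a • v) y =
      (a • FiberBundle.extend E v : Π y : N, TangentSpace 𝓘(ℝ, E) y) y := by
    filter_upwards [e.open_baseSet.mem_nhds hxe] with y hy
    change e.symm y (e ⟨ι x, a • v⟩).2 = a • e.symm y (e ⟨ι x, v⟩).2
    rw [h1, ← e.symmₗ_apply (R := ℝ) hy, ← e.symmₗ_apply (R := ℝ) hy, map_smul]
  have : IsManifold 𝓘(ℝ, E) 1 N := IsManifold.of_le (n := ∞) (by simp)
  have hv := mdifferentiableAt_extend v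
  rw [D.isCovariantDerivativeOnUniv.congr_of_eventuallyEq (mdifferentiableAt_extend (a • v))
    (mdifferentiableAt_const.smul_section hv) Filter.univ_mem h2]
  exact D.isCovariantDerivativeOnUniv.smul_const _ hv

theorem along_add (hσ : DiffAlongAt F ι σ x) (hτ : DiffAlongAt F ι τ x)
    (u : TangentSpace 𝓘(ℝ, F) x) :
    along D ι (σ + τ) x u = along D ι σ x u + along D ι τ x u := by
  have h1 : mvfderiv 𝓘(ℝ, F) (coordsAlong ι x (σ + τ)) x =
      mvfderiv 𝓘(ℝ, F) (coordsAlong ι x σ) x + mvfderiv 𝓘(ℝ, F) (coordsAlong ι x τ) x := by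
    rw [mvfderiv_congr (coordsAlong_add (diffAlongAt_iff.1 hσ).1.continuousAt),
      mvfderiv_add (diffAlongAt_iff.1 hσ).2 (diffAlongAt_iff.1 hτ).2]
  have h2 : D (FiberBundle.extend E ((σ + τ) x)) (ι x) =
      D (FiberBundle.extend E (σ x)) (ι x) + D (FiberBundle.extend E (τ x)) (ι x) := by
    rw [Pi.add_apply, covariantDerivative_extend_add]
  rw [along_eq, along_eq, along_eq, h1, h2, add_apply, add_apply, map_add]
  abel

theorem along_smul (hc : MDifferentiableAt 𝓘(ℝ, F) 𝓘(ℝ, ℝ) c x) (hσ : DiffAlongAt F ι σ x)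
    (u : TangentSpace 𝓘(ℝ, F) x) :
    along D ι (fun y ↦ c y • σ y) x u =
      c x • along D ι σ x u + mvfderiv 𝓘(ℝ, F) c x u • σ x := by
  have h1 : mvfderiv 𝓘(ℝ, F) (coordsAlong ι x (fun y ↦ c y • σ y)) x =
      c x • mvfderiv 𝓘(ℝ, F) (coordsAlong ι x σ) x +
        (mvfderiv 𝓘(ℝ, F) c x).smulRight (coordsAlong ι x σ x) := by
    rw [mvfderiv_congr (coordsAlong_smul (diffAlongAt_iff.1 hσ).1.continuousAt),
      mvfderiv_smul hc (diffAlongAt_iff.1 hσ).2]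
  have h2 : D (FiberBundle.extend E (c x • σ x)) (ι x) =
      c x • D (FiberBundle.extend E (σ x)) (ι x) := by
    rw [covariantDerivative_extend_smul]
  have h3 : (trivializationAt E (TangentSpace 𝓘(ℝ, E) : N → Type _) (ι x)).symmₗ ℝ (ι x)
      (coordsAlong ι x σ x) = σ x := by
    rw [Trivialization.symmₗ_apply (R := ℝ) _ (FiberBundle.mem_baseSet_trivializationAt' (ι x))]
    exact FiberBundle.extend_apply_self E (σ x)
  rw [along_eq, along_eq, h1, h2, add_apply, map_add, smul_add, FunLike.coe_smul, Pi.smul_apply,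
    FunLike.coe_smul, Pi.smul_apply, map_smul, ContinuousLinearMap.smulRight_apply, map_smul, h3]
  abel

end Along

end SectionsAlong

/-! ### Tensor fields along a map -/

section TensorsAlong

variable {E : Type*} [NormedAddCommGroup E] [NormedSpace ℝ E] [FiniteDimensional ℝ E]
  {N : Type*} [TopologicalSpace N] [ChartedSpace E N] [IsManifold 𝓘(ℝ, E) ∞ N]
  {F : Type*} [NormedAddCommGroup F] [NormedSpace ℝ F] [FiniteDimensional ℝ F]
  {M : Type*} [TopologicalSpace M] [ChartedSpace F M] [IsManifold 𝓘(ℝ, F) ∞ M]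
  {g : Π x : N, TangentSpace 𝓘(ℝ, E) x →L[ℝ] TangentSpace 𝓘(ℝ, E) x →L[ℝ] ℝ} {ν : ℕ}
  {J : Π x : N, TangentSpace 𝓘(ℝ, E) x →L[ℝ] TangentSpace 𝓘(ℝ, E) x} {p q : ℕ}
  {D : CovariantDerivative 𝓘(ℝ, E) E (TangentSpace 𝓘(ℝ, E) : N → Type _)}
  {ι : M → N} {σ τ : Π x : M, TangentSpace 𝓘(ℝ, E) (ι x)} {x : M}

theorem IsMetallicStructure.diffAlongAt (hJ : IsMetallicStructure g J p q)
    (hσ : DiffAlongAt F ι σ x) : DiffAlongAt F ι (fun y ↦ J (ι y) (σ y)) x :=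
  MDifferentiableAt.clm_bundle_apply (IB := 𝓘(ℝ, E))
    ((hJ.smooth.mdifferentiableAt (by simp)).comp x (diffAlongAt_iff.1 hσ).1) hσ

theorem IsMetallicStructure.mdifferentiableAt (hJ : IsMetallicStructure g J p q) {x : N}
    {X : Π y : N, TangentSpace 𝓘(ℝ, E) y} (hX : MDifferentiableAt 𝓘(ℝ, E) 𝓘(ℝ, E).tangent
      (fun y ↦ (⟨y, X y⟩ : TangentBundle 𝓘(ℝ, E) N)) x) :
    MDifferentiableAt 𝓘(ℝ, E) 𝓘(ℝ, E).tangent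
      (fun y ↦ (⟨y, J y (X y)⟩ : TangentBundle 𝓘(ℝ, E) N)) x :=
  MDifferentiableAt.clm_bundle_apply (IB := 𝓘(ℝ, E)) (hJ.smooth.mdifferentiableAt (by simp)) hX

theorem IsSemiRiemannianMetric.mdifferentiableAt (hg : IsSemiRiemannianMetric g ν)
    (hσ : DiffAlongAt F ι σ x) (hτ : DiffAlongAt F ι τ x) :
    MDifferentiableAt 𝓘(ℝ, F) 𝓘(ℝ, ℝ) (fun y ↦ g (ι y) (σ y) (τ y)) x := by
  have : MDifferentiableAt 𝓘(ℝ, F) (𝓘(ℝ, E).prod 𝓘(ℝ))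
      (fun y ↦ TotalSpace.mk' ℝ (E := Bundle.Trivial N ℝ) (ι y) (g (ι y) (σ y) (τ y))) x := by
    apply MDifferentiableAt.clm_bundle_apply₂ (F₁ := E) (F₂ := E)
    · exact (hg.smooth.mdifferentiableAt (by simp)).comp x (diffAlongAt_iff.1 hσ).1
    · exact hσ
    · exact hτ
  rw [mdifferentiableAt_totalSpace] at this
  exact this.2

theorem IsSemiRiemannianMetric.contMDiffAt (hg : IsSemiRiemannianMetric g ν)
    (hσ : SmoothAlongAt F ι σ x) (hτ : SmoothAlongAt F ι τ x) :
    ContMDiffAt 𝓘(ℝ, F) 𝓘(ℝ, ℝ) ∞ (fun y ↦ g (ι y) (σ y) (τ y)) x := by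
  have : ContMDiffAt 𝓘(ℝ, F) (𝓘(ℝ, E).prod 𝓘(ℝ)) ∞
      (fun y ↦ TotalSpace.mk' ℝ (E := Bundle.Trivial N ℝ) (ι y) (g (ι y) (σ y) (τ y))) x := by
    apply ContMDiffAt.clm_bundle_apply₂ (F₁ := E) (F₂ := E)
    · exact hg.smooth.contMDiffAt.comp x (smoothAlongAt_iff.1 hσ).1
    · exact hσ
    · exact hτ
  rw [contMDiffAt_totalSpace] at this
  exact this.2

/-- A parallel tensor field commutes with the derivative along a map. -/
theorem IsParallelTensor.along_apply (hpar : IsParallelTensor D J)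
    (hJ : IsMetallicStructure g J p q) (hσ : DiffAlongAt F ι σ x) (u : TangentSpace 𝓘(ℝ, F) x) :
    along D ι (fun y ↦ J (ι y) (σ y)) x u = J (ι x) (along D ι σ x u) := by
  have hι := (diffAlongAt_iff.1 hσ).1
  refine hσ.induction
    (P := fun ρ ↦ along D ι (fun y ↦ J (ι y) (ρ y)) x u = J (ι x) (along D ι ρ x u)) ?_ ?_ ?_ ?_
  · intro X hX
    rw [along_comp D ι (fun y ↦ J y (X y)) x hι (hJ.mdifferentiableAt hX), along_comp D ι X x hι hX,
      hpar X _ hX]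
  · intro ρ₁ ρ₂ h₁ h₂ e₁ e₂
    rw [along_add D h₁ h₂, map_add, ← e₁, ← e₂,
      ← along_add D (hJ.diffAlongAt h₁) (hJ.diffAlongAt h₂)]
    refine along_congr D (.of_forall fun y ↦ ?_) u
    simp
  · intro a ρ ha h e
    rw [along_smul D ha h, map_add, map_smul, map_smul, ← e, ← along_smul D ha (hJ.diffAlongAt h)]
    refine along_congr D (.of_forall fun y ↦ ?_) u
    simp
  · intro ρ₁ ρ₂ h e
    rw [← along_congr D h, ← e]
    refine along_congr D (h.mono fun y hy ↦ ?_) u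
    rw [hy]

/-- The Levi-Civita connection, pulled back along a map, is metric. -/
theorem IsLeviCivita.along_metric (hD : IsLeviCivita g D) (hg : IsSemiRiemannianMetric g ν)
    (hσ : DiffAlongAt F ι σ x) (hτ : DiffAlongAt F ι τ x) (u : TangentSpace 𝓘(ℝ, F) x) :
    mvfderiv 𝓘(ℝ, F) (fun y ↦ g (ι y) (σ y) (τ y)) x u =
      g (ι x) (along D ι σ x u) (τ x) + g (ι x) (σ x) (along D ι τ x u) := by
  have hι := (diffAlongAt_iff.1 hσ).1
  let Q : (Π x : M, TangentSpace 𝓘(ℝ, E) (ι x)) → (Π x : M, TangentSpace 𝓘(ℝ, E) (ι x)) → Prop :=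
    fun ρ τ ↦ mvfderiv 𝓘(ℝ, F) (fun y ↦ g (ι y) (ρ y) (τ y)) x u =
      g (ι x) (along D ι ρ x u) (τ x) + g (ι x) (ρ x) (along D ι τ x u)
  -- as `g` is symmetric, reducing one argument to restrictions of ambient fields suffices
  have hsymm : ∀ ρ τ, Q ρ τ → Q τ ρ := by
    intro ρ τ h
    simp only [Q] at h ⊢
    simp only [hg.symm (ι _) (τ _) _, hg.symm (ι _) _ (ρ _)]
    rw [h, add_comm]
  have key : ∀ τ, DiffAlongAt F ι τ x →
      (∀ X : Π y : N, TangentSpace 𝓘(ℝ, E) y, MDifferentiableAt 𝓘(ℝ, E) 𝓘(ℝ, E).tangent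
        (fun y ↦ (⟨y, X y⟩ : TangentBundle 𝓘(ℝ, E) N)) (ι x) → Q (fun y ↦ X (ι y)) τ) →
      ∀ ρ, DiffAlongAt F ι ρ x → Q ρ τ := by
    intro τ hτ hX ρ hρ
    refine hρ.induction (P := fun ρ ↦ Q ρ τ) hX ?_ ?_ ?_
    · intro ρ₁ ρ₂ h₁ h₂ e₁ e₂
      have h3 : mvfderiv 𝓘(ℝ, F) (fun y ↦ g (ι y) ((ρ₁ + ρ₂) y) (τ y)) x =
          mvfderiv 𝓘(ℝ, F) (fun y ↦ g (ι y) (ρ₁ y) (τ y)) x +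
            mvfderiv 𝓘(ℝ, F) (fun y ↦ g (ι y) (ρ₂ y) (τ y)) x := by
        rw [← mvfderiv_add (hg.mdifferentiableAt h₁ hτ) (hg.mdifferentiableAt h₂ hτ)]
        refine mvfderiv_congr (.of_forall fun y ↦ ?_)
        simp
      simp only [Q] at e₁ e₂ ⊢
      rw [h3, add_apply, e₁, e₂, along_add D h₁ h₂]
      simp only [Pi.add_apply, map_add, add_apply]
      ring
    · intro a ρ ha h e
      have h3 : mvfderiv 𝓘(ℝ, F) (fun y ↦ g (ι y) (a y • ρ y) (τ y)) x =
          a x • mvfderiv 𝓘(ℝ, F) (fun y ↦ g (ι y) (ρ y) (τ y)) x +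
            (g (ι x) (ρ x) (τ x)) • mvfderiv 𝓘(ℝ, F) a x := by
        rw [← mvfderiv_mul ha (hg.mdifferentiableAt h hτ)]
        refine mvfderiv_congr (.of_forall fun y ↦ ?_)
        simp
      simp only [Q] at e ⊢
      rw [h3, along_smul D ha h, add_apply, FunLike.coe_smul, FunLike.coe_smul, Pi.smul_apply,
        Pi.smul_apply, e]
      simp only [map_add, map_smul, add_apply, FunLike.coe_smul, Pi.smul_apply, smul_eq_mul]
      ring
    · intro ρ₁ ρ₂ h e
      simp only [Q] at e ⊢
      rw [← along_congr D h, ← h.self_of_nhds, ← e]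
      refine DFunLike.congr_fun (mvfderiv_congr (h.mono fun y hy ↦ ?_)) u
      simp only [hy]
  refine key τ hτ (fun X hX ↦ hsymm _ _ (key _ (hX.comp x hι) (fun Y hY ↦ ?_) τ hτ)) σ hσ
  simp only [Q]
  rw [along_comp D ι X x hι hX, along_comp D ι Y x hι hY, ← hD.metric Y X (ι x) hY hX]
  have hd := hg.mdifferentiableAt (F := E) (ι := fun y : N ↦ y) (x := ι x) hY hX
  exact mvfderiv_comp_apply (I' := 𝓘(ℝ, F)) x hd hι u

theorem along_quarterSymmetric (pi : Π x : N, TangentSpace 𝓘(ℝ, E) x →L[ℝ] ℝ)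
    (σ : Π x : M, TangentSpace 𝓘(ℝ, E) (ι x)) (u : TangentSpace 𝓘(ℝ, F) x) :
    along (quarterSymmetric D J pi) ι σ x u =
      along D ι σ x u + pi (ι x) (σ x) • J (ι x) (mfderiv 𝓘(ℝ, F) 𝓘(ℝ, E) ι x u) := by
  rw [along_eq, along_eq, add_assoc]
  congr 1
  change D (FiberBundle.extend E (σ x)) (ι x) (mfderiv 𝓘(ℝ, F) 𝓘(ℝ, E) ι x u) +
    pi (ι x) (FiberBundle.extend E (σ x) (ι x)) • J (ι x) (mfderiv 𝓘(ℝ, F) 𝓘(ℝ, E) ι x u) = _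
  rw [FiberBundle.extend_apply_self]

end TensorsAlong

/-! ### Extension of vectors to global sections -/

section Extension

variable {E : Type*} [NormedAddCommGroup E] [NormedSpace ℝ E] [FiniteDimensional ℝ E]
  {N : Type*} [TopologicalSpace N] [ChartedSpace E N] [IsManifold 𝓘(ℝ, E) ∞ N]
  {F : Type*} [NormedAddCommGroup F] [NormedSpace ℝ F] [FiniteDimensional ℝ F]
  {M : Type*} [TopologicalSpace M] [ChartedSpace F M] [IsManifold 𝓘(ℝ, F) ∞ M]
  {ι : M → N} {P : Π x : M, Submodule ℝ (TangentSpace 𝓘(ℝ, E) (ι x))} {x : M}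

/-- A local smooth section agrees at a given point with a global one, by means of a bump function. -/
theorem exists_isSection_of_local [T2Space M] (hι : ContMDiff 𝓘(ℝ, F) 𝓘(ℝ, E) ∞ ι)
    {s : Π x : M, TangentSpace 𝓘(ℝ, E) (ι x)} {O : Set M} (hO : IsOpen O) (hx : x ∈ O)
    (hs : ∀ y ∈ O, SmoothAlongAt F ι s y) (hP : ∀ y ∈ O, s y ∈ P y) :
    ∃ σ, IsSection (F := F) ι P σ ∧ σ x = s x := by
  obtain ⟨f, -, hf⟩ := (SmoothBumpFunction.nhds_basis_tsupport (I := 𝓘(ℝ, F)) x).mem_iff.1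
    (hO.mem_nhds hx)
  refine ⟨fun y ↦ f y • s y, ⟨fun y ↦ ?_, fun y ↦ ?_⟩, ?_⟩
  · by_cases hy : y ∈ O
    · exact SmoothAlongAt.smul f.contMDiffAt (hs y hy)
    · have h0 : ∀ᶠ z in 𝓝 y, f z = 0 := by
        filter_upwards [(isClosed_tsupport f).isOpen_compl.mem_nhds (fun h ↦ hy (hf h))] with z hz
        exact image_eq_zero_of_notMem_tsupport hz
      refine (smoothAlongAt_zero (hι y)).congr_of_eventuallyEq (h0.mono fun z hz ↦ ?_)
      simp [hz]
  · by_cases hy : y ∈ O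
    · exact (P y).smul_mem _ (hP y hy)
    · simp [image_eq_zero_of_notMem_tsupport (fun h ↦ hy (hf h))]
  · simp

theorem IsSubbundle.exists_isSection [T2Space M] (hι : ContMDiff 𝓘(ℝ, F) 𝓘(ℝ, E) ∞ ι) {k : ℕ}
    (hP : IsSubbundle (F := F) ι P k) {v : TangentSpace 𝓘(ℝ, E) (ι x)} (hv : v ∈ P x) :
    ∃ σ, IsSection (F := F) ι P σ ∧ σ x = v := by
  obtain ⟨O, hO, hx, s, hs, hframe⟩ := hP x
  rw [← (hframe x hx).2] at hv
  obtain ⟨a, ha⟩ := (Submodule.mem_span_range_iff_exists_fun ℝ).1 hv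
  have hsum : ∀ y, (∑ i, fun z ↦ a i • s i z : Π x : M, TangentSpace 𝓘(ℝ, E) (ι x)) y =
      ∑ i, a i • s i y := fun y ↦ Finset.sum_apply ..
  obtain ⟨σ, hσ, hσx⟩ := exists_isSection_of_local (F := F) (P := P) hι
    (s := ∑ i, fun z ↦ a i • s i z) hO hx
    (fun y hy ↦ SmoothAlongAt.sum _ (hι y) fun i _ ↦
      SmoothAlongAt.smul contMDiffAt_const ((hs i).contMDiffAt (hO.mem_nhds hy)))
    (fun y hy ↦ by
      rw [hsum, ← (hframe y hy).2]
      exact Submodule.sum_mem _ fun i _ ↦ Submodule.smul_mem _ _ (Submodule.subset_span ⟨i, rfl⟩))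
  exact ⟨σ, hσ, by rw [hσx, hsum, ha]⟩

theorem contMDiffAt_det {k : ℕ} {A : M → Matrix (Fin k) (Fin k) ℝ}
    (hA : ∀ i j, ContMDiffAt 𝓘(ℝ, F) 𝓘(ℝ, ℝ) ∞ (fun y ↦ A y i j) x) :
    ContMDiffAt 𝓘(ℝ, F) 𝓘(ℝ, ℝ) ∞ (fun y ↦ (A y).det) x := by
  simp only [Matrix.det_apply']
  exact contMDiffAt_finsetSum fun σ _ ↦
    contMDiffAt_const.mul (contMDiffAt_finsetProd fun i _ ↦ hA (σ i) i)

theorem contMDiffAt_adjugate {k : ℕ} {A : M → Matrix (Fin k) (Fin k) ℝ}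
    (hA : ∀ i j, ContMDiffAt 𝓘(ℝ, F) 𝓘(ℝ, ℝ) ∞ (fun y ↦ A y i j) x) (i j : Fin k) :
    ContMDiffAt 𝓘(ℝ, F) 𝓘(ℝ, ℝ) ∞ (fun y ↦ (A y).adjugate i j) x := by
  simp only [Matrix.adjugate_apply]
  refine contMDiffAt_det fun l m ↦ ?_
  by_cases h : l = j
  · subst h
    simpa using contMDiffAt_const
  · simpa [Matrix.updateRow_ne h] using hA l m

end Extension

namespace LightlikeSubmanifold

variable {E : Type*} [NormedAddCommGroup E] [NormedSpace ℝ E] [FiniteDimensional ℝ E]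
  {N : Type*} [TopologicalSpace N] [ChartedSpace E N] [IsManifold 𝓘(ℝ, E) ∞ N]
  {F : Type*} [NormedAddCommGroup F] [NormedSpace ℝ F] [FiniteDimensional ℝ F]
  {M : Type*} [TopologicalSpace M] [ChartedSpace F M] [IsManifold 𝓘(ℝ, F) ∞ M]
  {g : Π x : N, TangentSpace 𝓘(ℝ, E) x →L[ℝ] TangentSpace 𝓘(ℝ, E) x →L[ℝ] ℝ}
  {J : Π x : N, TangentSpace 𝓘(ℝ, E) x →L[ℝ] TangentSpace 𝓘(ℝ, E) x} {p q : ℕ}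
  {ι : M → N} {r ν : ℕ} {H : LightlikeSubmanifold F g ι r}
  {B : Π x : M, Submodule ℝ (TangentSpace 𝓘(ℝ, E) (ι x))} {x : M}

/-! ### Orthogonality in the decomposition along a lightlike submanifold -/

section Orthogonality

theorem screen_le_tangent (H : LightlikeSubmanifold F g ι r) (x : M) :
    H.screen x ≤ tangentSpaceOf (F := F) ι x :=
  H.screen_sup x ▸ le_sup_right

theorem inner_screen_ltr (H : LightlikeSubmanifold F g ι r) {v w : TangentSpace 𝓘(ℝ, E) (ι x)}
    (hv : v ∈ H.screen x) (hw : w ∈ H.ltr x) : g (ι x) v w = 0 :=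
  (H.ltr_sup x ▸ le_sup_right : H.ltr x ≤ (formAt g (ι x)).orthogonal (H.screen x ⊔ H.screenTr x))
    hw v (Submodule.mem_sup_left hv)

theorem inner_tangent_screenTr (H : LightlikeSubmanifold F g ι r)
    {v w : TangentSpace 𝓘(ℝ, E) (ι x)} (hv : v ∈ tangentSpaceOf (F := F) ι x)
    (hw : w ∈ H.screenTr x) : g (ι x) v w = 0 :=
  (H.screenTr_sup x ▸ le_sup_right :
    H.screenTr x ≤ (formAt g (ι x)).orthogonal (tangentSpaceOf (F := F) ι x)) hw v hv

theorem inner_tangent_radical {v w : TangentSpace 𝓘(ℝ, E) (ι x)}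
    (hv : v ∈ tangentSpaceOf (F := F) ι x) (hw : w ∈ radical F g ι x) : g (ι x) v w = 0 :=
  hw.2 v hv

theorem tangentPart_mem (hg : IsSemiRiemannianMetric g ν) (v : TangentSpace 𝓘(ℝ, E) (ι x)) :
    H.tangentPart hg x v ∈ tangentSpaceOf (F := F) ι x :=
  Submodule.projection_apply_mem _ _

theorem ltrPart_mem (hg : IsSemiRiemannianMetric g ν) (v : TangentSpace 𝓘(ℝ, E) (ι x)) :
    H.ltrPart hg x v ∈ H.ltr x :=
  Submodule.projection_apply_mem _ _

theorem exists_screenTr (hg : IsSemiRiemannianMetric g ν) (v : TangentSpace 𝓘(ℝ, E) (ι x)) :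
    ∃ w ∈ H.screenTr x, v = H.tangentPart hg x v + H.ltrPart hg x v + w := by
  have hv : v ∈ tangentSpaceOf (F := F) ι x ⊔ (H.ltr x ⊔ H.screenTr x) := by
    rw [(H.isCompl hg x).1.sup_eq_top]
    trivial
  obtain ⟨t, ht, m, hm, rfl⟩ := Submodule.mem_sup.1 hv
  obtain ⟨l, hl, w, hw, rfl⟩ := Submodule.mem_sup.1 hm
  have h1 : H.tangentPart hg x (t + (l + w)) = t := by
    rw [map_add, tangentPart, Submodule.projection_apply_of_mem_left _ ht,
      Submodule.projection_apply_of_mem_right _ hm, add_zero]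
  have h2 : H.ltrPart hg x (t + (l + w)) = l := by
    rw [show t + (l + w) = l + (t + w) by abel, map_add, ltrPart,
      Submodule.projection_apply_of_mem_left _ hl,
      Submodule.projection_apply_of_mem_right _
        (add_mem (Submodule.mem_sup_left ht) (Submodule.mem_sup_right hw)), add_zero]
  exact ⟨w, hw, by rw [h1, h2, add_assoc]⟩

/-- A screen vector is orthogonal to both transversal bundles, so it only sees tangential parts. -/
theorem inner_tangentPart (hg : IsSemiRiemannianMetric g ν) {z : TangentSpace 𝓘(ℝ, E) (ι x)}
    (hz : z ∈ H.screen x) (v : TangentSpace 𝓘(ℝ, E) (ι x)) :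
    g (ι x) z (H.tangentPart hg x v) = g (ι x) z v := by
  obtain ⟨w, hw, h⟩ := H.exists_screenTr hg v
  conv_rhs => rw [h]
  rw [map_add, map_add, H.inner_screen_ltr hz (H.ltrPart_mem hg v),
    H.inner_tangent_screenTr (H.screen_le_tangent x hz) hw, add_zero, add_zero]

/-- A radical vector only sees `ltr(TM)`-parts. -/
theorem inner_ltrPart (hg : IsSemiRiemannianMetric g ν) {e : TangentSpace 𝓘(ℝ, E) (ι x)}
    (he : e ∈ radical F g ι x) (v : TangentSpace 𝓘(ℝ, E) (ι x)) :
    g (ι x) e (H.ltrPart hg x v) = g (ι x) e v := by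
  obtain ⟨w, hw, h⟩ := H.exists_screenTr hg v
  conv_rhs => rw [h]
  rw [map_add, map_add, hg.symm _ e (H.tangentPart hg x v),
    inner_tangent_radical (H.tangentPart_mem hg v) he, H.inner_tangent_screenTr he.1 hw,
    zero_add, add_zero]

end Orthogonality

/-! ### The distributions of a screen semi-invariant submanifold -/

namespace IsScreenSemiInvariant

theorem le_tangent (hB : H.IsScreenSemiInvariant J B) (x : M) :
    B x ⊔ radical F g ι x ≤ tangentSpaceOf (F := F) ι x :=
  sup_le ((hB.le_screen x).trans (H.screen_le_tangent x)) inf_le_left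

theorem inner_perp (hg : IsSemiRiemannianMetric g ν)
    {v z : TangentSpace 𝓘(ℝ, E) (ι x)} (hv : v ∈ B x ⊔ radical F g ι x)
    (hz : z ∈ H.perpInScreen B x) : g (ι x) v z = 0 := by
  obtain ⟨f, hf, e, he, rfl⟩ := Submodule.mem_sup.1 hv
  have h1 : g (ι x) f z = 0 := hz.2 f hf
  rw [map_add, add_apply, h1, hg.symm, inner_tangent_radical (H.screen_le_tangent x hz.1) he,
    add_zero]

/-- `B ⊕ Rad(TM)` is the orthogonal complement of `B^⊥` in `TM`. -/
theorem mem_of_inner_perp (hg : IsSemiRiemannianMetric g ν) (hB : H.IsScreenSemiInvariant J B)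
    {v : TangentSpace 𝓘(ℝ, E) (ι x)} (hv : v ∈ tangentSpaceOf (F := F) ι x)
    (h : ∀ z ∈ H.perpInScreen B x, g (ι x) v z = 0) : v ∈ B x ⊔ radical F g ι x := by
  rw [← H.screen_sup x] at hv
  obtain ⟨e, he, s, hs, rfl⟩ := Submodule.mem_sup.1 hv
  rw [← hB.sup_perp x] at hs
  obtain ⟨f, hf, c, hc, rfl⟩ := Submodule.mem_sup.1 hs
  have hfe : f + e ∈ B x ⊔ radical F g ι x :=
    add_mem (Submodule.mem_sup_left hf) (Submodule.mem_sup_right he)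
  have hperp : ∀ z ∈ H.perpInScreen B x, g (ι x) c z = 0 := by
    intro z hz
    have h1 := h z hz
    rw [show e + (f + c) = (f + e) + c by abel, map_add, add_apply, inner_perp hg hfe hz,
      zero_add] at h1
    exact h1
  -- `c` is a screen vector orthogonal to all of `TM`
  have hcr : c ∈ radical F g ι x := by
    refine ⟨H.screen_le_tangent x hc.1, fun t ht ↦ ?_⟩
    rw [← H.screen_sup x] at ht
    obtain ⟨e', he', s', hs', rfl⟩ := Submodule.mem_sup.1 ht
    rw [← hB.sup_perp x] at hs'
    obtain ⟨f', hf', c', hc', rfl⟩ := Submodule.mem_sup.1 hs'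
    change g (ι x) (e' + (f' + c')) c = 0
    rw [show e' + (f' + c') = (f' + e') + c' by abel, map_add, add_apply,
      inner_perp hg (add_mem (Submodule.mem_sup_left hf') (Submodule.mem_sup_right he')) hc,
      hg.symm, hperp c' hc', add_zero]
  have hc0 : c ∈ radical F g ι x ⊓ H.screen x := ⟨hcr, hc.1⟩
  rw [H.screen_inf x, Submodule.mem_bot] at hc0
  rw [hc0, add_zero, add_comm]
  exact hfe

theorem map_radical_mem (hB : H.IsScreenSemiInvariant J B) {e : TangentSpace 𝓘(ℝ, E) (ι x)}
    (he : e ∈ radical F g ι x) : J (ι x) e ∈ radical F g ι x := by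
  have h : J (ι x) e ∈ (radical F g ι x).map (J (ι x)).toLinearMap :=
    Submodule.mem_map_of_mem (f := (J (ι x)).toLinearMap) he
  rwa [hB.map_radical x] at h

theorem map_mem (hB : H.IsScreenSemiInvariant J B) {f : TangentSpace 𝓘(ℝ, E) (ι x)}
    (hf : f ∈ B x) : J (ι x) f ∈ B x := by
  have h : J (ι x) f ∈ (B x).map (J (ι x)).toLinearMap :=
    Submodule.mem_map_of_mem (f := (J (ι x)).toLinearMap) hf
  rwa [hB.map_eq x] at h

theorem map_sup_mem (hB : H.IsScreenSemiInvariant J B) {v : TangentSpace 𝓘(ℝ, E) (ι x)}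
    (hv : v ∈ B x ⊔ radical F g ι x) : J (ι x) v ∈ B x ⊔ radical F g ι x := by
  obtain ⟨f, hf, e, he, rfl⟩ := Submodule.mem_sup.1 hv
  rw [map_add]
  exact add_mem (Submodule.mem_sup_left (hB.map_mem hf))
    (Submodule.mem_sup_right (hB.map_radical_mem he))

theorem exists_eq_map_map (hB : H.IsScreenSemiInvariant J B) {v : TangentSpace 𝓘(ℝ, E) (ι x)}
    (hv : v ∈ B x ⊔ radical F g ι x) :
    ∃ f ∈ B x, ∃ e ∈ radical F g ι x, v = J (ι x) (J (ι x) f) + J (ι x) (J (ι x) e) := by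
  obtain ⟨f, hf, e, he, rfl⟩ := Submodule.mem_sup.1 hv
  rw [← hB.map_eq x, ← hB.map_eq x] at hf
  rw [← hB.map_radical x, ← hB.map_radical x] at he
  obtain ⟨-, ⟨f, hf, rfl⟩, rfl⟩ := hf
  obtain ⟨-, ⟨e, he, rfl⟩, rfl⟩ := he
  exact ⟨f, hf, e, he, rfl⟩

/-- Every vector of `B^⊥` is the value of a smooth section of `B^⊥`. Near the point, extend the
vector to a section `S` of the screen distribution and subtract its orthogonal projection to `B`,
which the Gram matrix `G` of a frame of `B` expresses. Multiplied by `det G`, the difference is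
`det G • S` minus the combination of the frame with coefficients `adj G` applied to the products
of `S` with the frame, in which no inverse occurs. -/
theorem exists_isSection_perp [T2Space M] (hg : IsSemiRiemannianMetric g ν)
    (hι : ContMDiff 𝓘(ℝ, F) 𝓘(ℝ, E) ∞ ι) (hB : H.IsScreenSemiInvariant J B)
    {z : TangentSpace 𝓘(ℝ, E) (ι x)} (hz : z ∈ H.perpInScreen B x) :
    ∃ Z, IsSection (F := F) ι (H.perpInScreen B) Z ∧ Z x = z := by
  obtain ⟨m, hm⟩ := H.screen_subbundle
  obtain ⟨S, hS, hSx⟩ := hm.exists_isSection hι hz.1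
  obtain ⟨k, hk⟩ := hB.subbundle
  obtain ⟨O, hO, hxO, b, hb, hframe⟩ := hk x
  have hbsm : ∀ i, ∀ y ∈ O, SmoothAlongAt F ι (b i) y := fun i y hy ↦
    (hb i).contMDiffAt (hO.mem_nhds hy)
  have hbB : ∀ i, ∀ y ∈ O, b i y ∈ B y := fun i y hy ↦ by
    rw [← (hframe y hy).2]
    exact Submodule.subset_span ⟨i, rfl⟩
  let G : M → Matrix (Fin k) (Fin k) ℝ := fun y ↦ .of fun i j ↦ g (ι y) (b i y) (b j y)
  have hG : ∀ y ∈ O, ∀ i j, ContMDiffAt 𝓘(ℝ, F) 𝓘(ℝ, ℝ) ∞ (fun w ↦ G w i j) y :=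
    fun y hy i j ↦ hg.contMDiffAt (hbsm i y hy) (hbsm j y hy)
  -- `B` is nondegenerate, so its Gram matrix is invertible
  have hdet : (G x).det ≠ 0 := by
    intro h0
    obtain ⟨a, ha, hGa⟩ := Matrix.exists_mulVec_eq_zero_iff.2 h0
    refine ha ?_
    have hsum : ∑ i, a i • b i x = 0 := by
      refine hB.non_null x _ (Submodule.sum_mem _ fun i _ ↦
        Submodule.smul_mem _ _ (hbB i x hxO)) fun w hw ↦ ?_
      rw [← (hframe x hxO).2] at hw
      obtain ⟨d, rfl⟩ := (Submodule.mem_span_range_iff_exists_fun ℝ).1 hw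
      rw [map_sum]
      refine Finset.sum_eq_zero fun j _ ↦ ?_
      have h1 := congrFun hGa j
      simp only [Matrix.mulVec, dotProduct, G, Matrix.of_apply, Pi.zero_apply] at h1
      rw [map_smul, hg.symm, map_sum]
      simp only [map_smul, smul_eq_mul, mul_comm (a _), h1, mul_zero]
    exact funext fun i ↦ Fintype.linearIndependent_iff.1 (hframe x hxO).1 a hsum i
  let c : Fin k → M → ℝ := fun i y ↦ ∑ j, (G y).adjugate i j * g (ι y) (b j y) (S y)
  have hc : ∀ y ∈ O, ∀ i, ContMDiffAt 𝓘(ℝ, F) 𝓘(ℝ, ℝ) ∞ (c i) y := fun y hy i ↦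
    contMDiffAt_finsetSum fun j _ ↦ (contMDiffAt_adjugate (hG y hy) i j).mul
      (hg.contMDiffAt (hbsm j y hy) (hS.1 y))
  let Z₀ : Π x : M, TangentSpace 𝓘(ℝ, E) (ι x) :=
    (fun y ↦ (G y).det • S y) + ∑ i, fun y ↦ (-c i y) • b i y
  have hZ₀ : ∀ y, Z₀ y = (G y).det • S y + ∑ i, (-c i y) • b i y := fun y ↦ by
    simp only [Z₀, Pi.add_apply, Finset.sum_apply]
  have hsm : ∀ y ∈ O, SmoothAlongAt F ι Z₀ y := fun y hy ↦
    (SmoothAlongAt.smul (contMDiffAt_det (hG y hy)) (hS.1 y)).add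
      (SmoothAlongAt.sum _ (hι y) fun i _ ↦ SmoothAlongAt.smul (hc y hy i).neg (hbsm i y hy))
  have hmem : ∀ y ∈ O, Z₀ y ∈ H.perpInScreen B y := by
    intro y hy
    refine ⟨?_, fun w hw ↦ ?_⟩
    · rw [hZ₀]
      exact add_mem (Submodule.smul_mem _ _ (hS.2 y)) (Submodule.sum_mem _ fun i _ ↦
        Submodule.smul_mem _ _ (hB.le_screen y (hbB i y hy)))
    · rw [← (hframe y hy).2] at hw
      obtain ⟨d, rfl⟩ := (Submodule.mem_span_range_iff_exists_fun ℝ).1 hw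
      change g (ι y) (∑ i, d i • b i y) (Z₀ y) = 0
      rw [map_sum, sum_apply]
      refine Finset.sum_eq_zero fun l _ ↦ ?_
      -- the row `l` of `G * adj G = det G • 1`
      have h1 := congrFun (congrArg (Matrix.mulVec · fun j ↦ g (ι y) (b j y) (S y))
        (Matrix.mul_adjugate (G y))) l
      simp only [← Matrix.mulVec_mulVec, Matrix.smul_mulVec, Matrix.one_mulVec, Pi.smul_apply,
        smul_eq_mul] at h1
      have h2 : ∑ i, g (ι y) (b l y) (b i y) * c i y =
          (G y).det * g (ι y) (b l y) (S y) := h1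
      rw [map_smul, FunLike.coe_smul, Pi.smul_apply, hZ₀, map_add, map_smul, map_sum]
      simp only [map_smul, smul_eq_mul, neg_mul, Finset.sum_neg_distrib]
      rw [← h2]
      simp only [mul_comm (c _ _)]
      ring
  obtain ⟨Z, hZ, hZx⟩ := exists_isSection_of_local (P := H.perpInScreen B) hι hO hxO
    (s := fun y ↦ (G x).det⁻¹ • Z₀ y) (fun y hy ↦ SmoothAlongAt.smul contMDiffAt_const (hsm y hy))
    (fun y hy ↦ Submodule.smul_mem _ _ (hmem y hy))
  refine ⟨Z, hZ, ?_⟩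
  have hcx : ∀ i, c i x = 0 := fun i ↦ Finset.sum_eq_zero fun j _ ↦ by
    rw [hSx, show g (ι x) (b j x) z = 0 from hz.2 _ (hbB j x hxO), mul_zero]
  rw [hZx, hZ₀, hSx]
  simp [hcx, smul_smul, hdet]

/-! ### Reduction to the Levi-Civita connection -/

variable {nabla : CovariantDerivative 𝓘(ℝ, E) E (TangentSpace 𝓘(ℝ, E) : N → Type _)}
  {pi : Π x : N, TangentSpace 𝓘(ℝ, E) x →L[ℝ] ℝ}
  {Z V : Π x : M, TangentSpace 𝓘(ℝ, E) (ι x)} {U : Π x : M, TangentSpace 𝓘(ℝ, F) x} {x : M}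

/-- The function `g(V, Z)` vanishes, and so does its derivative. -/
theorem inner_along_eq_neg (hg : IsSemiRiemannianMetric g ν) (hnabla : IsLeviCivita g nabla)
    (hV : IsSection (F := F) ι (fun x ↦ B x ⊔ radical F g ι x) V)
    (hZ : IsSection (F := F) ι (H.perpInScreen B) Z) (u : TangentSpace 𝓘(ℝ, F) x) :
    g (ι x) (along nabla ι V x u) (Z x) = -g (ι x) (V x) (along nabla ι Z x u) := by
  have h := hnabla.along_metric hg (SmoothAlongAt.diffAlongAt (hV.1 x))
    (SmoothAlongAt.diffAlongAt (hZ.1 x)) u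
  have h0 : mvfderiv 𝓘(ℝ, F) (fun y ↦ g (ι y) (V y) (Z y)) x u = 0 := by
    rw [show (fun y ↦ g (ι y) (V y) (Z y)) = fun _ ↦ (0 : ℝ) from
      funext fun y ↦ inner_perp hg (hV.2 y) (hZ.2 y)]
    exact DFunLike.congr_fun (mvfderiv_const 0) u
  linarith

theorem inner_map_along_map (hJ : IsMetallicStructure g J p q)
    (hpar : IsParallelTensor nabla J) (hZ : IsSection (F := F) ι (H.perpInScreen B) Z)
    (v : TangentSpace 𝓘(ℝ, E) (ι x)) (u : TangentSpace 𝓘(ℝ, F) x) :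
    g (ι x) (J (ι x) v) (along nabla ι (fun y ↦ J (ι y) (Z y)) x u) =
      g (ι x) (J (ι x) (J (ι x) v)) (along nabla ι Z x u) := by
  rw [hpar.along_apply hJ (SmoothAlongAt.diffAlongAt (hZ.1 x)), hJ.compatible]

/-- The term `π(V) J U` of the quarter symmetric connection stays in `B ⊕ Rad(TM)`, hence only the
Levi-Civita part decides whether the induced derivative lies there. -/
theorem inducedConnection_mem_iff (hg : IsSemiRiemannianMetric g ν)
    (hB : H.IsScreenSemiInvariant J B) (hU : push ι U x ∈ B x ⊔ radical F g ι x) :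
    H.inducedConnection hg (quarterSymmetric nabla J pi) U V x ∈ B x ⊔ radical F g ι x ↔
      ∀ z ∈ H.perpInScreen B x, g (ι x) (along nabla ι V x (U x)) z = 0 := by
  have key : ∀ z ∈ H.perpInScreen B x,
      g (ι x) (H.inducedConnection hg (quarterSymmetric nabla J pi) U V x) z =
        g (ι x) (along nabla ι V x (U x)) z := by
    intro z hz
    have h0 : g (ι x) (J (ι x) (mfderiv 𝓘(ℝ, F) 𝓘(ℝ, E) ι x (U x))) z = 0 :=
      inner_perp hg (hB.map_sup_mem hU) hz
    rw [inducedConnection, hg.symm, H.inner_tangentPart hg hz.1, hg.symm, along_quarterSymmetric,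
      map_add, add_apply, map_smul, FunLike.coe_smul, Pi.smul_apply, h0, smul_zero, add_zero]
  constructor
  · intro h z hz
    rw [← key z hz]
    exact inner_perp hg h hz
  · intro h
    exact mem_of_inner_perp hg hB (H.tangentPart_mem hg _) fun z hz ↦ (key z hz).trans (h z hz)

/-- For radical vectors both terms on the right vanish, and the `ltr(TM)`-part may be replaced by
the whole derivative. -/
theorem radical_condition_iff (hg : IsSemiRiemannianMetric g ν) (hB : H.IsScreenSemiInvariant J B)
    (hU : push ι U x ∈ B x ⊔ radical F g ι x) {e : TangentSpace 𝓘(ℝ, E) (ι x)}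
    (he : e ∈ radical F g ι x) (W : Π x : M, TangentSpace 𝓘(ℝ, E) (ι x)) :
    (g (ι x) (J (ι x) e) (H.ltrDeriv hg (quarterSymmetric nabla J pi) U W x) =
      g (ι x) (H.shape hg (quarterSymmetric nabla J pi) W U x) (J (ι x) e) +
        pi (ι x) (W x) * g (ι x) (J (ι x) (push ι U x)) (J (ι x) e)) ↔
      g (ι x) (J (ι x) e) (along nabla ι W x (U x)) = 0 := by
  have hJe := hB.map_radical_mem he
  have h1 : g (ι x) (J (ι x) (push ι U x)) (J (ι x) e) = 0 :=
    inner_tangent_radical (hB.le_tangent x (hB.map_sup_mem hU)) hJe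
  have h2 : g (ι x) (H.shape hg (quarterSymmetric nabla J pi) W U x) (J (ι x) e) = 0 :=
    inner_tangent_radical (neg_mem (H.tangentPart_mem hg _)) hJe
  have h3 : g (ι x) (J (ι x) e) (J (ι x) (mfderiv 𝓘(ℝ, F) 𝓘(ℝ, E) ι x (U x))) = 0 := by
    rw [hg.symm]
    exact h1
  rw [h1, h2, mul_zero, add_zero, ltrDeriv, H.inner_ltrPart hg hJe, along_quarterSymmetric, map_add,
    map_smul, h3, smul_zero, add_zero]

/-- The term with `π` is the contribution of the quarter symmetric connection to the shape
operator. -/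
theorem screen_condition_iff (hg : IsSemiRiemannianMetric g ν) (hB : H.IsScreenSemiInvariant J B)
    {f : TangentSpace 𝓘(ℝ, E) (ι x)} (hf : f ∈ B x) (W : Π x : M, TangentSpace 𝓘(ℝ, E) (ι x)) :
    (g (ι x) (H.shape hg (quarterSymmetric nabla J pi) W U x) (J (ι x) f) =
      -(pi (ι x) (W x)) * g (ι x) (J (ι x) (push ι U x)) (J (ι x) f)) ↔
      g (ι x) (J (ι x) f) (along nabla ι W x (U x)) = 0 := by
  have h1 : g (ι x) (H.shape hg (quarterSymmetric nabla J pi) W U x) (J (ι x) f) =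
      -g (ι x) (J (ι x) f) (along nabla ι W x (U x)) -
        pi (ι x) (W x) * g (ι x) (J (ι x) (push ι U x)) (J (ι x) f) := by
    rw [hg.symm, shape, map_neg, H.inner_tangentPart hg (hB.le_screen x (hB.map_mem hf)),
      along_quarterSymmetric, map_add, map_smul, smul_eq_mul, hg.symm _ (J (ι x) (push ι U x)), push]
    ring
  rw [h1]
  constructor <;> intro h <;> linarith

end IsScreenSemiInvariant

end LightlikeSubmanifold

end LightlikeGeometry

open LightlikeSubmanifold.IsScreenSemiInvariant in
theorem mainTheorem11
    {EN : Type*} [NormedAddCommGroup EN] [NormedSpace ℝ EN] [FiniteDimensional ℝ EN]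
    {N : Type*} [TopologicalSpace N] [T2Space N] [SigmaCompactSpace N]
    [ChartedSpace EN N] [IsManifold 𝓘(ℝ, EN) ∞ N]
    {EM : Type*} [NormedAddCommGroup EM] [NormedSpace ℝ EM] [FiniteDimensional ℝ EM]
    {M : Type*} [TopologicalSpace M] [T2Space M] [SigmaCompactSpace M]
    [ChartedSpace EM M] [IsManifold 𝓘(ℝ, EM) ∞ M]
    (g : Π x : N, TangentSpace 𝓘(ℝ, EN) x →L[ℝ] TangentSpace 𝓘(ℝ, EN) x →L[ℝ] ℝ) (ν : ℕ)
    (hg : IsSemiRiemannianMetric g ν)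
    (J : Π x : N, TangentSpace 𝓘(ℝ, EN) x →L[ℝ] TangentSpace 𝓘(ℝ, EN) x) (p q : ℕ)
    (hJ : IsMetallicStructure g J p q)
    (nabla : CovariantDerivative 𝓘(ℝ, EN) EN (TangentSpace 𝓘(ℝ, EN) : N → Type _))
    (hnabla : IsLeviCivita g nabla) (hparallel : IsParallelTensor nabla J)
    (η : Π x : N, TangentSpace 𝓘(ℝ, EN) x) (hη : IsSmoothVectorField η)
    (pi : Π x : N, TangentSpace 𝓘(ℝ, EN) x →L[ℝ] ℝ) (hpi : pi = associatedForm g η)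
    (D : CovariantDerivative 𝓘(ℝ, EN) EN (TangentSpace 𝓘(ℝ, EN) : N → Type _))
    (hD : D = quarterSymmetric nabla J pi)
    (ι : M → N) (r : ℕ) (H : LightlikeSubmanifold EM g ι r)
    (B : Π x : M, Submodule ℝ (TangentSpace 𝓘(ℝ, EN) (ι x)))
    (hB : H.IsScreenSemiInvariant J B) :
    H.DefinesTotallyGeodesicFoliation hg D (fun x ↦ B x ⊔ radical EM g ι x) ↔
      (∀ (E Z : Π x : M, TangentSpace 𝓘(ℝ, EN) (ι x)) (U : Π x : M, TangentSpace 𝓘(ℝ, EM) x),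
        IsSection (F := EM) ι (radical EM g ι) E →
        IsSmoothVectorField U →
        IsSection (F := EM) ι (fun x ↦ B x ⊔ radical EM g ι x) (push ι U) →
        IsSection (F := EM) ι (H.perpInScreen B) Z →
        ∀ x, g (ι x) (J (ι x) (E x)) (H.ltrDeriv hg D U (fun y ↦ J (ι y) (Z y)) x) =
          g (ι x) (H.shape hg D (fun y ↦ J (ι y) (Z y)) U x) (J (ι x) (E x)) +
            pi (ι x) (J (ι x) (Z x)) * g (ι x) (J (ι x) (push ι U x)) (J (ι x) (E x))) ∧
      (∀ (F Z : Π x : M, TangentSpace 𝓘(ℝ, EN) (ι x)) (U : Π x : M, TangentSpace 𝓘(ℝ, EM) x),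
        IsSection (F := EM) ι B F →
        IsSmoothVectorField U →
        IsSection (F := EM) ι (fun x ↦ B x ⊔ radical EM g ι x) (push ι U) →
        IsSection (F := EM) ι (H.perpInScreen B) Z →
        ∀ x, g (ι x) (H.shape hg D (fun y ↦ J (ι y) (Z y)) U x) (J (ι x) (F x)) =
          -(pi (ι x) (J (ι x) (Z x))) * g (ι x) (J (ι x) (push ι U x)) (J (ι x) (F x))) := by
  subst hD
  have hι : ContMDiff 𝓘(ℝ, EM) 𝓘(ℝ, EN) ∞ ι := H.immersion.contMDiff
  constructor
  · intro h
    -- `g(J e, ∇_U (J Z))` is read off from a section of `B'` with the value `J (J e)` at the point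
    have key : ∀ {k : ℕ} (P : Π x : M, Submodule ℝ (TangentSpace 𝓘(ℝ, EN) (ι x))),
        IsSubbundle (F := EM) ι P k → (∀ y, P y ≤ B y ⊔ radical EM g ι y) →
        ∀ (Z : Π x : M, TangentSpace 𝓘(ℝ, EN) (ι x)) (U : Π x : M, TangentSpace 𝓘(ℝ, EM) x),
        IsSmoothVectorField U →
        IsSection (F := EM) ι (fun x ↦ B x ⊔ radical EM g ι x) (push ι U) →
        IsSection (F := EM) ι (H.perpInScreen B) Z →
        ∀ x e, J (ι x) (J (ι x) e) ∈ P x →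
          g (ι x) (J (ι x) e) (along nabla ι (fun y ↦ J (ι y) (Z y)) x (U x)) = 0 := by
      intro k P hP hPB Z U hU hU' hZ x e he
      obtain ⟨V, hV, hVx⟩ := hP.exists_isSection hι he
      have hV' : IsSection (F := EM) ι (fun x ↦ B x ⊔ radical EM g ι x) V :=
        ⟨hV.1, fun y ↦ hPB y (hV.2 y)⟩
      have h0 := (inducedConnection_mem_iff hg hB (hU'.2 x)).1 (h U V hU hU' hV' x) _ (hZ.2 x)
      rw [inner_along_eq_neg hg hnabla hV' hZ, hVx] at h0
      rw [inner_map_along_map hJ hparallel hZ]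
      exact neg_eq_zero.1 h0
    obtain ⟨k, hk⟩ := hB.subbundle
    refine ⟨fun E Z U hE hU hU' hZ x ↦ ?_, fun F Z U hF hU hU' hZ x ↦ ?_⟩
    · exact (radical_condition_iff hg hB (hU'.2 x) (hE.2 x) fun y ↦ J (ι y) (Z y)).2
        (key _ H.radical_subbundle (fun _ ↦ le_sup_right) Z U hU hU' hZ x _
          (hB.map_radical_mem (hB.map_radical_mem (hE.2 x))))
    · exact (screen_condition_iff hg hB (hF.2 x) fun y ↦ J (ι y) (Z y)).2
        (key _ hk (fun _ ↦ le_sup_left) Z U hU hU' hZ x _ (hB.map_mem (hB.map_mem (hF.2 x))))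
  · rintro ⟨h1, h2⟩ U V hU hU' hV x
    refine (inducedConnection_mem_iff hg hB (hU'.2 x)).2 fun z hz ↦ ?_
    obtain ⟨Z, hZ, rfl⟩ := hB.exists_isSection_perp hg hι hz
    obtain ⟨f, hf, e, he, hVx⟩ := hB.exists_eq_map_map (hV.2 x)
    obtain ⟨k, hk⟩ := hB.subbundle
    obtain ⟨F, hF, rfl⟩ := hk.exists_isSection hι hf
    obtain ⟨E, hE, rfl⟩ := H.radical_subbundle.exists_isSection hι he
    have h1' := (radical_condition_iff hg hB (hU'.2 x) (hE.2 x) fun y ↦ J (ι y) (Z y)).1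
      (h1 E Z U hE hU hU' hZ x)
    have h2' := (screen_condition_iff hg hB (hF.2 x) fun y ↦ J (ι y) (Z y)).1
      (h2 F Z U hF hU hU' hZ x)
    rw [inner_map_along_map hJ hparallel hZ] at h1' h2'
    rw [inner_along_eq_neg hg hnabla hV hZ, hVx, map_add, add_apply, h1', h2', add_zero, neg_zero]
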